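/- Let $\ell\in\mathbb N=\{1,2,\dots\}$, let $(X,\mathcal B,\mu)$ be a probability space, and let $T_1,\dots,T_\ell:X\to X$ be invertible (bi-measurable) measure preserving transformations with $T_iT_j=T_jT_i$ for all $i,j$, each of which is weakly mixing, i.e. $T_i\times T_i$ is ergodic for $\mu\times\mu$. Let $f_1,\dots,f_\ell\in L^\infty(\mu)$ be complex valued. Let $\mathcal R$ be the set of real functions $g$ that are $C^\infty$ on some half-line $[x_0,\infty)$ and such that for every integer $j\ge 0$ the quotient $x g^{(j+1)}(x)/g^{(j)}(x)$ is defined for all large $x$ and has a finite limit as $x\to\infty$. For an integer $i\ge 0$ let $\mathcal T_i$ be the set of $g\in\mathcal R$ such that $\lim_{x\to\infty} x g'(x)/g(x)=\alpha$ for some $\alpha\in(i,i+1]$ and $\lim_{x\to\infty}g^{(i+1)}(x)=0$, and let $\mathcal T=\bigcup_{i\ge 0}\mathcal T_i$. Write $h\prec g$ if $|g(x)|/|h(x)|\to\infty$ as $x\to\infty$. Let $g_1,\dots,g_\ell\in\mathcal T$ with $g_\ell\prec g_{\ell-1}\prec\cdots\prec g_1$. Then $$\lim_{N\to\infty}\left\|\frac1N\sum_{n=1}^N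 \prod_{i=1}^{\ell} f_i\circ T_i^{[g_i(n)]}-\prod_{i=1}^\ell\int f_i\,d\mu\right\|_{L^2(\mu)}=0,$$ where $[\cdot]$ is the floor function. (The finitely many terms in which some $g_i(n)$ is undefined may be given any values $g_i(n)\in\mathbb R$; they do not affect the limit.) -/

import Mathlib

open MeasureTheory Filter Topology
open scoped ContDiff ENNReal

namespace TemperedErgodic

/-- The class `𝓡`: real functions that are smooth on some half-line `[x₀, ∞)` and such that, for
every `j ≥ 0`, the quotient `x g⁽ʲ⁺¹⁾(x) / g⁽ʲ⁾(x)` is defined for all large `x` and has a finite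
limit as `x → ∞`. A function on a half-line is represented by a total function `ℝ → ℝ`, whose
values to the left of `x₀` are irrelevant. -/
def ClassR (g : ℝ → ℝ) : Prop :=
  (∃ x₀ : ℝ, ContDiffOn ℝ ∞ g (Set.Ici x₀)) ∧
    ∀ j : ℕ, (∀ᶠ x in atTop, iteratedDeriv j g x ≠ 0) ∧
      ∃ c : ℝ, Tendsto (fun x : ℝ => x * iteratedDeriv (j + 1) g x / iteratedDeriv j g x)
        atTop (𝓝 c)

/-- The class `𝓣ᵢ`: functions `g` in `𝓡` such that `x g'(x) / g(x) → α` for some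
`α ∈ (i, i + 1]`, and `g⁽ⁱ⁺¹⁾(x) → 0`. -/
def ClassTDeg (i : ℕ) (g : ℝ → ℝ) : Prop :=
  ClassR g ∧
    (∃ α : ℝ, (i : ℝ) < α ∧ α ≤ (i : ℝ) + 1 ∧
      Tendsto (fun x : ℝ => x * deriv g x / g x) atTop (𝓝 α)) ∧
    Tendsto (iteratedDeriv (i + 1) g) atTop (𝓝 0)

/-- The class `𝓣`, the union of the classes `𝓣ᵢ` over `i ≥ 0`. -/
def ClassT (g : ℝ → ℝ) : Prop := ∃ i : ℕ, ClassTDeg i g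

/-- `GrowsSlower g₂ g₁` is `g₂ ≺ g₁`: the quotient `|g₁(x)| / |g₂(x)|` tends to `∞` as `x → ∞`.
(As `y / 0 = 0` here, this forces `g₂` to have no zeros near infinity.) -/
def GrowsSlower (g₂ g₁ : ℝ → ℝ) : Prop :=
  Tendsto (fun x : ℝ => |g₁ x| / |g₂ x|) atTop atTop

/-- A map `T` preserving `μ` is weakly mixing if `T × T` is ergodic for `μ × μ`. -/
structure WeaklyMixing {X : Type*} [MeasurableSpace X] (μ : Measure X) (T : X → X) : Prop where
  measurePreserving : MeasurePreserving T μ μ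
  ergodic_prod : Ergodic (Prod.map T T) (μ.prod μ)

/-- The average `(1/N) ∑_{n=1}^N ∏ᵢ fᵢ (Tᵢ^[gᵢ(n)] x)`, where `[·]` is the floor and integer powers
of the invertible maps `Tᵢ` are taken under composition. -/
noncomputable def ergodicAverage {X : Type*} [MeasurableSpace X] {ℓ : ℕ} (T : Fin ℓ → X ≃ᵐ X)
    (g : Fin ℓ → ℝ → ℝ) (f : Fin ℓ → X → ℂ) (N : ℕ) (x : X) : ℂ :=
  (1 / (N : ℂ)) * ∑ n ∈ Finset.Icc 1 N,
    ∏ i : Fin ℓ, f i (((T i).toEquiv ^ ⌊g i (n : ℝ)⌋ : Equiv.Perm X) x)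

end TemperedErgodic

/-! Telescoping ∏ aᵢ − ∏ cᵢ with cᵢ = ∫ fᵢ reduces the theorem to averages in which only the indices
i ≥ i₀ occur and f_{i₀}, attached to the fastest remaining function, has mean zero
(`uNull_prod_sub_prod`). For these the property `UNull` is proved: averages of |∫ F uₙ| tend to zero
uniformly over |F| ≤ 1. Testing against the average itself turns this into L² convergence
(`UNull.tendsto_eLpNorm`). The absolute values make the notion stable under time changes, and van
der Corput's inequality still yields it.

Let g_{i₀} ∈ 𝓣ₑ and d = e + 1. The d-th derivatives of all gᵢ with i ≥ i₀ are eventually bounded, so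
by Taylor a shift n ↦ n + h acts on combinations of the derivatives of order < d as exp(h∂), up to a
bounded error. Integer parts of such combinations therefore behave like polynomials and are recorded
by their coefficients alone, a lower order of differentiation playing the role of a higher degree.
Bounded errors, those of the floor included, take finitely many values in ℤ^ℓ and are absorbed by
translating the functions fᵢ. Polynomial exhaustion (`pet_induction`, `normGood_evalSeq`) applies
van der Corput until only the e-th derivatives remain, while the distinguished term stays separated
from the others in the direction i₀.

In that base case ψ = |g_{i₀}^{(e)}| tends to infinity with derivative decreasing to 0. A time
change makes ψ linear and the other gᵢ^{(e)} slowly varying, because their derivatives are o(ψ')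
(`hasTimeChange_derivSystem`). Sequences that are linear along T_{i₀} and almost constant in the
other directions are settled by weak mixing of T_{i₀} (`normGood_of_almost_linear`). -/

namespace TemperedErgodic

/-! ### Sequences with vanishing Cesàro averages -/

/-- The averages `(1/N) ∑_{n<N} x n` of a nonnegative sequence tend to zero. -/
def CesNull (x : ℕ → ℝ) : Prop :=
  ∀ ε > 0, ∀ᶠ N : ℕ in atTop, ∑ n ∈ Finset.range N, x n ≤ ε * N

lemma CesNull.zero : CesNull fun _ => 0 := by
  intro ε hε
  filter_upwards with N
  simp; positivity

lemma CesNull.add {x y : ℕ → ℝ} (hx : CesNull x) (hy : CesNull y) :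
    CesNull fun n => x n + y n := by
  intro ε hε
  filter_upwards [hx (ε / 2) (by positivity), hy (ε / 2) (by positivity)] with N h1 h2
  rw [Finset.sum_add_distrib]; linarith

lemma CesNull.sum {κ : Type*} (s : Finset κ) {x : κ → ℕ → ℝ} (hx : ∀ k ∈ s, CesNull (x k)) :
    CesNull fun n => ∑ k ∈ s, x k n := by
  classical
  induction s using Finset.induction_on with
  | empty => simpa using CesNull.zero
  | insert a s ha ih =>
    have h := (hx a (by simp)).add (ih fun k hk => hx k (by simp [hk]))
    simpa [Finset.sum_insert ha] using h

lemma CesNull.const_mul {x : ℕ → ℝ} (hx : CesNull x) {C : ℝ} (hC : 0 ≤ C) :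
    CesNull fun n => C * x n := by
  intro ε hε
  filter_upwards [hx (ε / (C + 1)) (by positivity)] with N h
  rw [← Finset.mul_sum]
  calc C * ∑ n ∈ Finset.range N, x n ≤ C * (ε / (C + 1) * N) := by gcongr
    _ = (C / (C + 1)) * (ε * N) := by ring
    _ ≤ 1 * (ε * N) := by
        gcongr
        rw [div_le_one (by positivity)]; linarith
    _ = ε * N := one_mul _

lemma CesNull.of_eventually_zero {x : ℕ → ℝ} (hx : ∀ᶠ n in atTop, x n = 0) : CesNull x := by
  obtain ⟨m, hm⟩ := eventually_atTop.1 hx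
  intro ε hε
  have : ∀ᶠ N : ℕ in atTop, (∑ n ∈ Finset.range m, x n) ≤ ε * N :=
    ((tendsto_natCast_atTop_atTop (R := ℝ)).const_mul_atTop hε).eventually_ge_atTop _
  filter_upwards [this, eventually_ge_atTop m] with N h1 h2
  rw [← Finset.sum_range_add_sum_Ico _ h2]
  have : ∑ n ∈ Finset.Ico m N, x n = 0 :=
    Finset.sum_eq_zero fun n hn => hm n (Finset.mem_Ico.1 hn).1
  linarith

lemma CesNull.mono {x y : ℕ → ℝ} (hy : CesNull y) (h : ∀ n, x n ≤ y n) : CesNull x := by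
  intro ε hε
  filter_upwards [hy ε hε] with N hN
  exact (Finset.sum_le_sum fun n _ => h n).trans hN

lemma CesNull.mono_eventually {x y : ℕ → ℝ} (hy : CesNull y) (h : ∀ᶠ n in atTop, x n ≤ y n) :
    CesNull x := by
  have h1 : CesNull fun n => max (x n - y n) 0 :=
    .of_eventually_zero (h.mono fun n hn => by simpa using hn)
  refine (hy.add h1).mono fun n => ?_
  have := le_max_left (x n - y n) 0
  linarith

/-- Cauchy–Schwarz. It removes the square that the product system T × T produces. -/
lemma CesNull.of_sq {x : ℕ → ℝ} (h : CesNull fun n => x n ^ 2) : CesNull x := by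
  intro ε hε
  filter_upwards [h (ε ^ 2) (by positivity)] with N hN
  have h1 := sq_sum_le_card_mul_sum_sq (s := Finset.range N) (f := x)
  rw [Finset.card_range] at h1
  have h2 : (∑ n ∈ Finset.range N, x n) ^ 2 ≤ (ε * N) ^ 2 := by
    calc _ ≤ (N : ℝ) * ∑ n ∈ Finset.range N, x n ^ 2 := h1
      _ ≤ N * (ε ^ 2 * N) := by gcongr
      _ = _ := by ring
  exact abs_le_of_sq_le_sq' h2 (by positivity) |>.2

/-! ### Van der Corput's inequality -/

section vdC

variable {H : Type*} [NormedAddCommGroup H] [InnerProductSpace ℂ H]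

lemma sum_range_shift_sub_norm_le {E : Type*} [SeminormedAddCommGroup E] {v : ℕ → E} {B : ℝ}
    (hv : ∀ n, ‖v n‖ ≤ B) (N h : ℕ) :
    ‖∑ n ∈ Finset.range N, v n - ∑ n ∈ Finset.range N, v (n + h)‖ ≤ 2 * h * B := by
  induction h with
  | zero => simp
  | succ h ih =>
    have h1 : ∑ n ∈ Finset.range N, v (n + h) - ∑ n ∈ Finset.range N, v (n + (h + 1))
        = v h - v (N + h) := by
      have := Finset.sum_range_sub (fun n => v (n + h)) N
      rw [← Finset.sum_sub_distrib, ← neg_inj, ← Finset.sum_neg_distrib, neg_sub]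
      simp only [neg_sub]
      simp only [zero_add] at this
      rw [← this]
      exact Finset.sum_congr rfl fun n _ => by rw [show n + (h + 1) = n + 1 + h by ring]
    calc _ = ‖(∑ n ∈ Finset.range N, v n - ∑ n ∈ Finset.range N, v (n + h)) +
          (v h - v (N + h))‖ := by rw [← h1]; congr 1; abel
      _ ≤ 2 * h * B + (B + B) :=
          (norm_add_le _ _).trans (add_le_add ih ((norm_sub_le _ _).trans (add_le_add (hv _) (hv _))))
      _ = _ := by push_cast; ring

lemma sum_range_shift_le {x : ℕ → ℝ} {C : ℝ} (h0 : ∀ n, 0 ≤ x n) (hC : ∀ n, x n ≤ C) (N h : ℕ) :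
    ∑ n ∈ Finset.range N, x (n + h) ≤ ∑ n ∈ Finset.range N, x n + h * C := by
  calc ∑ n ∈ Finset.range N, x (n + h)
      ≤ ∑ n ∈ Finset.range h, x n + ∑ n ∈ Finset.range N, x (h + n) := by
        simp_rw [add_comm h]
        have := Finset.sum_nonneg fun n (_ : n ∈ Finset.range h) => h0 n
        linarith
    _ = ∑ n ∈ Finset.range N, x n + ∑ n ∈ Finset.range h, x (N + n) := by
        rw [← Finset.sum_range_add, ← Finset.sum_range_add, add_comm]
    _ ≤ _ := by
        gcongr
        calc _ ≤ ∑ n ∈ Finset.range h, C := Finset.sum_le_sum fun n _ => hC _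
          _ = _ := by simp

/-- For fixed a, each distance comes from at most one b ≤ a and at most one b > a. -/
lemma sum_sum_dist_le {R : ℕ → ℝ} (hR : ∀ k, 0 ≤ R k) (K : ℕ) :
    ∑ a ∈ Finset.range K, ∑ b ∈ Finset.range K, R (Nat.dist a b)
      ≤ 2 * K * ∑ k ∈ Finset.range K, R k := by
  have key : ∀ a ∈ Finset.range K, ∑ b ∈ Finset.range K, R (Nat.dist a b)
      ≤ 2 * ∑ k ∈ Finset.range K, R k := by
    intro a ha
    rw [Finset.mem_range] at ha
    rw [← Finset.sum_filter_add_sum_filter_not _ (fun b => b ≤ a), two_mul]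
    refine add_le_add ?_ ?_
    · rw [← Finset.sum_image (f := R) (g := fun b => Nat.dist a b)]
      · refine Finset.sum_le_sum_of_subset_of_nonneg ?_ fun _ _ _ => hR _
        intro k hk
        simp only [Finset.mem_image, Finset.mem_filter, Finset.mem_range, Nat.dist] at hk ⊢
        omega
      · intro x hx y hy hxy
        simp only [Finset.coe_filter, Finset.mem_range, Set.mem_ofPred_eq, Nat.dist] at hx hy hxy
        omega
    · rw [← Finset.sum_image (f := R) (g := fun b => Nat.dist a b)]
      · refine Finset.sum_le_sum_of_subset_of_nonneg ?_ fun _ _ _ => hR _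
        intro k hk
        simp only [Finset.mem_image, Finset.mem_filter, Finset.mem_range, Nat.dist] at hk ⊢
        omega
      · intro x hx y hy hxy
        simp only [Finset.coe_filter, Finset.mem_range, Set.mem_ofPred_eq, Nat.dist] at hx hy hxy
        omega
  calc _ ≤ ∑ a ∈ Finset.range K, 2 * ∑ k ∈ Finset.range K, R k := Finset.sum_le_sum key
    _ = _ := by simp; ring

lemma norm_sum_sq_le (v : ℕ → H) (K : ℕ) :
    ‖∑ a ∈ Finset.range K, v a‖ ^ 2
      ≤ ∑ a ∈ Finset.range K, ∑ b ∈ Finset.range K, ‖inner ℂ (v a) (v b)‖ := by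
  rw [← inner_self_eq_norm_sq (𝕜 := ℂ)]
  refine (RCLike.re_le_norm _).trans ?_
  rw [sum_inner]
  refine (norm_sum_le _ _).trans (Finset.sum_le_sum fun a _ => ?_)
  rw [inner_sum]
  exact norm_sum_le _ _

/-- A finite form of the van der Corput inequality. -/
lemma vdC_finite {v : ℕ → H} {B : ℝ} (hB : 0 ≤ B) (hv : ∀ n, ‖v n‖ ≤ B) (N K : ℕ) :
    K * ‖∑ n ∈ Finset.range N, v n‖ ≤ 2 * K ^ 2 * B + Real.sqrt (N * (2 * K *
      ∑ k ∈ Finset.range K, (∑ n ∈ Finset.range N, ‖inner ℂ (v (n + k)) (v n)‖ + K * B ^ 2))) := by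
  -- Sums over windows of length K. Moving a window start by h < K changes the total only at the
  -- ends, whence the error 2K²B; Cauchy–Schwarz in n then brings in the correlations.
  set Y : ℕ → H := fun n => ∑ h ∈ Finset.range K, v (n + h) with hY
  have h1 : ‖(K : ℂ) • ∑ n ∈ Finset.range N, v n - ∑ n ∈ Finset.range N, Y n‖ ≤ 2 * K ^ 2 * B := by
    have : (K : ℂ) • ∑ n ∈ Finset.range N, v n - ∑ n ∈ Finset.range N, Y n =
        ∑ h ∈ Finset.range K,
          (∑ n ∈ Finset.range N, v n - ∑ n ∈ Finset.range N, v (n + h)) := by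
      rw [Finset.sum_sub_distrib, Finset.sum_const, Finset.card_range, hY, Finset.sum_comm,
        Nat.cast_smul_eq_nsmul]
    rw [this]
    calc _ ≤ ∑ h ∈ Finset.range K, 2 * (K : ℝ) * B := by
          refine norm_sum_le_of_le _ fun h hh => ?_
          refine (sum_range_shift_sub_norm_le hv N h).trans ?_
          have : (h : ℝ) ≤ K := by exact_mod_cast (Finset.mem_range.1 hh).le
          gcongr
      _ = _ := by simp; ring
  have hin : ∀ a b, ‖inner ℂ (v a) (v b)‖ ≤ B ^ 2 := fun a b => by
    refine (norm_inner_le_norm _ _).trans ?_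
    rw [sq]
    exact mul_le_mul (hv _) (hv _) (norm_nonneg _) hB
  have hcorr : ∀ a ∈ Finset.range K, ∀ b ∈ Finset.range K,
      ∑ n ∈ Finset.range N, ‖inner ℂ (v (n + a)) (v (n + b))‖ ≤
        ∑ n ∈ Finset.range N, ‖inner ℂ (v (n + Nat.dist a b)) (v n)‖ + K * B ^ 2 := by
    have aux : ∀ a ∈ Finset.range K, ∀ b ∈ Finset.range K, b ≤ a →
        ∑ n ∈ Finset.range N, ‖inner ℂ (v (n + a)) (v (n + b))‖ ≤
        ∑ n ∈ Finset.range N, ‖inner ℂ (v (n + Nat.dist a b)) (v n)‖ + K * B ^ 2 := by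
      intro a ha b hb hab
      have e : ∀ n, n + a = n + b + Nat.dist a b := fun n => by simp only [Nat.dist]; omega
      simp_rw [e]
      refine (sum_range_shift_le (x := fun n => ‖inner ℂ (v (n + Nat.dist a b)) (v n)‖)
        (fun _ => norm_nonneg _) (fun _ => hin _ _) N b).trans ?_
      have : (b : ℝ) ≤ K := by exact_mod_cast (Finset.mem_range.1 hb).le
      gcongr
    intro a ha b hb
    rcases le_total b a with h | h
    · exact aux a ha b hb h
    · have := aux b hb a ha h
      rw [Nat.dist_comm]
      simpa only [norm_inner_symm] using this
  have h2 : ∑ n ∈ Finset.range N, ‖Y n‖ ^ 2 ≤ 2 * K *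
      ∑ k ∈ Finset.range K, (∑ n ∈ Finset.range N, ‖inner ℂ (v (n + k)) (v n)‖ + K * B ^ 2) := by
    calc _ ≤ ∑ n ∈ Finset.range N, ∑ a ∈ Finset.range K, ∑ b ∈ Finset.range K,
          ‖inner ℂ (v (n + a)) (v (n + b))‖ :=
          Finset.sum_le_sum fun n _ => norm_sum_sq_le (fun a => v (n + a)) K
      _ = ∑ a ∈ Finset.range K, ∑ b ∈ Finset.range K, ∑ n ∈ Finset.range N,
          ‖inner ℂ (v (n + a)) (v (n + b))‖ := by
          rw [Finset.sum_comm]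
          exact Finset.sum_congr rfl fun a _ => Finset.sum_comm
      _ ≤ ∑ a ∈ Finset.range K, ∑ b ∈ Finset.range K,
          (∑ n ∈ Finset.range N, ‖inner ℂ (v (n + Nat.dist a b)) (v n)‖ + K * B ^ 2) :=
          Finset.sum_le_sum fun a ha => Finset.sum_le_sum fun b hb => hcorr a ha b hb
      _ ≤ _ := sum_sum_dist_le (R := fun k => ∑ n ∈ Finset.range N,
          ‖inner ℂ (v (n + k)) (v n)‖ + K * B ^ 2) (fun k => by positivity) K
  have h3 : ‖∑ n ∈ Finset.range N, Y n‖ ≤ Real.sqrt (N * (2 * K *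
      ∑ k ∈ Finset.range K,
        (∑ n ∈ Finset.range N, ‖inner ℂ (v (n + k)) (v n)‖ + K * B ^ 2))) := by
    refine (norm_sum_le _ _).trans (Real.le_sqrt_of_sq_le ?_)
    refine (sq_sum_le_card_mul_sum_sq (s := Finset.range N) (f := fun n => ‖Y n‖)).trans ?_
    rw [Finset.card_range]
    gcongr
  have h4 : (K : ℝ) * ‖∑ n ∈ Finset.range N, v n‖ = ‖(K : ℂ) • ∑ n ∈ Finset.range N, v n‖ := by
    rw [norm_smul]; simp
  rw [h4]
  calc _ = ‖((K : ℂ) • ∑ n ∈ Finset.range N, v n - ∑ n ∈ Finset.range N, Y n)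
        + ∑ n ∈ Finset.range N, Y n‖ := by rw [sub_add_cancel]
    _ ≤ _ := (norm_add_le _ _).trans (add_le_add h1 h3)

lemma exists_norm_le_one_mul_eq_norm (z : ℂ) : ∃ w : ℂ, ‖w‖ ≤ 1 ∧ w * z = ‖z‖ := by
  by_cases hz : z = 0
  · exact ⟨0, by simp, by simp [hz]⟩
  · have : (‖z‖ : ℂ) ≠ 0 := by simpa using hz
    refine ⟨(starRingEnd ℂ) z / ‖z‖, ?_, ?_⟩
    · simp [hz]
    · rw [div_mul_eq_mul_div, mul_comm, Complex.mul_conj, Complex.normSq_eq_norm_sq, div_eq_iff this]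
      push_cast; ring

/-- Van der Corput's lemma, in a form that controls the averages of `|⟪F, u n⟫|` uniformly in the
unit vector `F`. -/
lemma vdC_uniform {u : ℕ → H} {B : ℝ} (hu : ∀ n, ‖u n‖ ≤ B) {γ : ℕ → ℝ} (hγ : CesNull γ)
    {z : ℕ → ℕ → ℝ} (hz : ∀ h, CesNull (z h))
    (hcorr : ∀ h, ∀ᶠ n in atTop, ‖inner ℂ (u (n + h)) (u n)‖ ≤ γ h + z h n) {ε : ℝ} (hε : 0 < ε) :
    ∀ᶠ N : ℕ in atTop, ∀ F : H, ‖F‖ ≤ 1 →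
      ∑ n ∈ Finset.range N, ‖inner ℂ F (u n)‖ ≤ ε * N := by
  have hB : 0 ≤ B := (norm_nonneg _).trans (hu 0)
  have h16 : 0 < ε ^ 2 / 16 := by positivity
  obtain ⟨K, hK, hK1⟩ := ((hγ _ h16).and (eventually_ge_atTop 1)).exists
  have hK0 : (0 : ℝ) < K := by exact_mod_cast hK1
  have hN1 : ∀ᶠ N : ℕ in atTop, ∀ k ∈ Finset.range K,
      ∑ n ∈ Finset.range N, ‖inner ℂ (u (n + k)) (u n)‖ ≤ γ k * N + ε ^ 2 / 32 * N := by
    rw [Finset.eventually_all]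
    intro k _
    have h1 : CesNull fun n => ‖inner ℂ (u (n + k)) (u n)‖ - γ k :=
      (hz k).mono_eventually ((hcorr k).mono fun n hn => by linarith)
    filter_upwards [h1 (ε ^ 2 / 32) (by positivity)] with N hN
    rw [Finset.sum_sub_distrib, Finset.sum_const, Finset.card_range, nsmul_eq_mul] at hN
    linarith
  have hN2 : ∀ᶠ N : ℕ in atTop, (K : ℝ) * B ^ 2 ≤ ε ^ 2 / 32 * N :=
    ((tendsto_natCast_atTop_atTop (R := ℝ)).const_mul_atTop
      (show 0 < ε ^ 2 / 32 by positivity)).eventually_ge_atTop _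
  have hN3 : ∀ᶠ N : ℕ in atTop, 2 * (K : ℝ) ^ 2 * B ≤ (K * ε / 2) * N :=
    ((tendsto_natCast_atTop_atTop (R := ℝ)).const_mul_atTop
      (show 0 < K * ε / 2 by positivity)).eventually_ge_atTop _
  filter_upwards [hN1, hN2, hN3] with N h1 h2 h3 F hF
  -- Weights of modulus at most 1 turn |⟪F, u n⟫| into ⟪F, w n • u n⟫ and do not increase the
  -- absolute values of the correlations, so the bound is uniform in F.
  choose w hw1 hw2 using fun n => exists_norm_le_one_mul_eq_norm (inner ℂ F (u n))
  set v : ℕ → H := fun n => w n • u n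
  have hv : ∀ n, ‖v n‖ ≤ B := fun n => by
    rw [norm_smul]
    calc _ ≤ 1 * B := mul_le_mul (hw1 n) (hu n) (norm_nonneg _) zero_le_one
      _ = B := one_mul B
  have hvin : ∀ k n, ‖inner ℂ (v (n + k)) (v n)‖ ≤ ‖inner ℂ (u (n + k)) (u n)‖ := fun k n => by
    simp only [v, inner_smul_left, inner_smul_right, norm_mul, RCLike.norm_conj]
    calc _ ≤ 1 * (1 * ‖inner ℂ (u (n + k)) (u n)‖) := by
          gcongr
          · exact hw1 _
          · exact hw1 _
      _ = _ := by ring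
  have h4 : ∑ n ∈ Finset.range N, ‖inner ℂ F (u n)‖ ≤ ‖∑ n ∈ Finset.range N, v n‖ := by
    have e : ((∑ n ∈ Finset.range N, ‖inner ℂ F (u n)‖ : ℝ) : ℂ)
        = inner ℂ F (∑ n ∈ Finset.range N, v n) := by
      rw [inner_sum]; push_cast
      exact Finset.sum_congr rfl fun n _ => by rw [inner_smul_right, hw2]
    calc _ = ‖((∑ n ∈ Finset.range N, ‖inner ℂ F (u n)‖ : ℝ) : ℂ)‖ := by
          rw [Complex.norm_real, Real.norm_of_nonneg (by positivity)]
      _ ≤ ‖F‖ * ‖∑ n ∈ Finset.range N, v n‖ := by rw [e]; exact norm_inner_le_norm _ _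
      _ ≤ 1 * _ := by gcongr
      _ = _ := one_mul _
  have h5 : ∑ k ∈ Finset.range K,
      (∑ n ∈ Finset.range N, ‖inner ℂ (v (n + k)) (v n)‖ + K * B ^ 2) ≤ ε ^ 2 / 8 * K * N := by
    calc _ ≤ ∑ k ∈ Finset.range K, (γ k * N + ε ^ 2 / 32 * N + ε ^ 2 / 32 * N) := by
          refine Finset.sum_le_sum fun k hk => add_le_add ?_ h2
          exact (Finset.sum_le_sum fun n _ => hvin k n).trans (h1 k hk)
      _ = (∑ k ∈ Finset.range K, γ k) * N + ε ^ 2 / 16 * K * N := by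
          simp only [Finset.sum_add_distrib, ← Finset.sum_mul, Finset.sum_const, Finset.card_range,
            nsmul_eq_mul]
          ring
      _ ≤ (ε ^ 2 / 16 * K) * N + ε ^ 2 / 16 * K * N := by gcongr
      _ = _ := by ring
  have h6 := vdC_finite hB hv N K
  have h7 : Real.sqrt (N * (2 * K *
      ∑ k ∈ Finset.range K, (∑ n ∈ Finset.range N, ‖inner ℂ (v (n + k)) (v n)‖ + K * B ^ 2)))
      ≤ K * ε / 2 * N := by
    rw [Real.sqrt_le_left (by positivity)]
    calc _ ≤ N * (2 * K * (ε ^ 2 / 8 * K * N)) := by gcongr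
      _ = _ := by ring
  refine h4.trans (le_of_mul_le_mul_left ?_ hK0)
  calc _ ≤ _ := h6
    _ ≤ K * ε / 2 * N + K * ε / 2 * N := add_le_add h3 h7
    _ = _ := by ring

end vdC

/-! ### Time changes with controlled fibres -/

section Counting

/-- `τ` spreads the integers evenly enough for averages along `τ` to be controlled by averages. -/
def EvenlySpread (τ : ℕ → ℕ) : Prop :=
  ∃ (C : ℝ) (n₀ : ℕ) (M : ℕ → ℕ), 0 ≤ C ∧ Tendsto M atTop atTop ∧ ∀ᶠ N in atTop,
    (∀ n ∈ Finset.Ico n₀ N, τ n < M N) ∧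
      ∀ m, ((Finset.Ico n₀ N).filter (fun n => τ n = m)).card * (M N : ℝ) ≤ C * N

lemma sum_comp_le_of_card_le {τ : ℕ → ℕ} {s : Finset ℕ} {M : ℕ} {L : ℝ}
    (hτ : ∀ n ∈ s, τ n < M) (hL : ∀ m, ((s.filter fun n => τ n = m).card : ℝ) ≤ L)
    {x : ℕ → ℝ} (hx : ∀ m, 0 ≤ x m) :
    ∑ n ∈ s, x (τ n) ≤ L * ∑ m ∈ Finset.range M, x m := by
  rw [← Finset.sum_fiberwise_of_maps_to (s := s) (t := Finset.range M) (g := τ)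
    (fun n hn => Finset.mem_range.2 (hτ n hn)), Finset.mul_sum]
  refine Finset.sum_le_sum fun m _ => ?_
  rw [Finset.sum_congr rfl (g := fun _ => x m)
    (fun n hn => by rw [(Finset.mem_filter.1 hn).2]), Finset.sum_const, nsmul_eq_mul]
  exact mul_le_mul_of_nonneg_right (hL m) (hx m)

lemma card_le_of_forall_sub_le {s : Finset ℕ} {L : ℝ} (hL : 0 ≤ L)
    (h : ∀ a ∈ s, ∀ b ∈ s, a ≤ b → (b : ℝ) - a ≤ L) : (s.card : ℝ) ≤ L + 1 := by
  rcases s.eq_empty_or_nonempty with rfl | hs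
  · simp; linarith
  · have hsub : s ⊆ Finset.Icc (s.min' hs) (s.max' hs) := fun a ha =>
      Finset.mem_Icc.2 ⟨s.min'_le a ha, s.le_max' a ha⟩
    have h1 := Finset.card_le_card hsub
    rw [Nat.card_Icc] at h1
    have h2 := s.min'_le_max' hs
    have h3 := h _ (s.min'_mem hs) _ (s.max'_mem hs) h2
    have h4 : (s.card : ℝ) + (s.min' hs : ℕ) ≤ (s.max' hs : ℕ) + 1 := by
      have : s.card + s.min' hs ≤ s.max' hs + 1 := by omega
      exact_mod_cast this
    linarith

/-- The threshold in N does not depend on x, so that it serves all test functions simultaneously in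
`UNull.of_comp`. -/
lemma EvenlySpread.eventually_sum_le {τ : ℕ → ℕ} (hτ : EvenlySpread τ) :
    ∃ (C : ℝ) (n₀ : ℕ), 0 ≤ C ∧ ∀ ε > 0, ∀ N₀ : ℕ, ∃ (M : ℕ → ℕ), ∀ᶠ N : ℕ in atTop,
      N₀ ≤ M N ∧ ∀ x : ℕ → ℝ, (∀ m, 0 ≤ x m) →
      (∑ m ∈ Finset.range (M N), x m ≤ ε * M N) →
        ∑ n ∈ Finset.Ico n₀ N, x (τ n) ≤ C * ε * N := by
  obtain ⟨C, n₀, M, hC, hM, h⟩ := hτ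
  refine ⟨C, n₀, hC, fun ε hε N₀ => ⟨M, ?_⟩⟩
  filter_upwards [h, hM.eventually_ge_atTop (N₀ + 1)] with N ⟨h1, h2⟩ h3
  refine ⟨by omega, fun x hx hsum => ?_⟩
  have hM0 : (0 : ℝ) < M N := by exact_mod_cast (by omega : 0 < M N)
  have := sum_comp_le_of_card_le h1 (L := C * N / M N)
    (fun m => by rw [le_div_iff₀ hM0]; exact h2 m) hx
  refine this.trans ?_
  calc _ ≤ C * N / M N * (ε * M N) := by gcongr
    _ = _ := by field_simp

lemma CesNull.comp {x : ℕ → ℝ} (hx : CesNull x) (h0 : ∀ m, 0 ≤ x m) {τ : ℕ → ℕ}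
    (hτ : EvenlySpread τ) : CesNull fun n => x (τ n) := by
  obtain ⟨C, n₀, hC, h⟩ := hτ.eventually_sum_le
  intro ε hε
  have hε' : 0 < ε / (2 * (C + 1)) := by positivity
  obtain ⟨N₀, hN₀⟩ := eventually_atTop.1 (hx _ hε')
  obtain ⟨M, hM⟩ := h _ hε' N₀
  have h1 : ∀ᶠ N : ℕ in atTop, ∑ n ∈ Finset.range n₀, x (τ n) ≤ ε / 2 * N :=
    ((tendsto_natCast_atTop_atTop (R := ℝ)).const_mul_atTop
      (show 0 < ε / 2 by positivity)).eventually_ge_atTop _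
  filter_upwards [hM, h1, eventually_ge_atTop n₀] with N ⟨h2, h3⟩ h4 h5
  have h6 := h3 x h0 (hN₀ _ h2)
  rw [← Finset.sum_range_add_sum_Ico _ h5]
  have h7 : C * (ε / (2 * (C + 1))) * N ≤ ε / 2 * N := by
    gcongr
    rw [mul_div_assoc', div_le_div_iff₀ (by positivity) (by positivity)]
    nlinarith
  linarith

/-- For n ≥ 1 the sign of ⌊cn⌋ is dictated by c, so the absolute value determines the floor and a
fibre has diameter at most 1/|c|. -/
lemma evenlySpread_natAbs_floor {c : ℝ} (hc : c ≠ 0) :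
    EvenlySpread fun n : ℕ => (⌊c * n⌋).natAbs := by
  have hc' : 0 < |c| := abs_pos.2 hc
  have habs : ∀ n : ℕ, ((⌊c * n⌋).natAbs : ℝ) < |c| * n + 1 := fun n => by
    rw [Nat.cast_natAbs, Int.cast_abs]
    have h1 := Int.floor_le (c * n)
    have h2 := Int.lt_floor_add_one (c * n)
    have h3 : |c| * n = |c * n| := by rw [abs_mul, Nat.abs_cast]
    rw [h3]
    rcases abs_cases (c * n) with ⟨h, _⟩ | ⟨h, _⟩ <;>
      rcases abs_cases (⌊c * n⌋ : ℝ) with ⟨h', _⟩ | ⟨h', _⟩ <;> linarith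
  refine ⟨(1 / |c| + 1) * (|c| + 2), 1, fun N => ⌈|c| * N⌉₊ + 1, by positivity, ?_, ?_⟩
  · refine tendsto_atTop_mono (fun N => Nat.le_succ _) (tendsto_nat_ceil_atTop.comp ?_)
    exact (tendsto_natCast_atTop_atTop (R := ℝ)).const_mul_atTop hc'
  filter_upwards [eventually_ge_atTop 1] with N hN
  constructor
  · intro n hn
    have h1 : |c| * n ≤ |c| * N := by
      have : (n : ℝ) ≤ N := by exact_mod_cast (Finset.mem_Ico.1 hn).2.le
      gcongr
    have h2 := Nat.le_ceil (|c| * N)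
    have h3 : ((⌊c * n⌋).natAbs : ℝ) < ((⌈|c| * N⌉₊ + 1 : ℕ) : ℝ) := by
      push_cast
      linarith [habs n]
    exact_mod_cast h3
  · intro m
    have h1 : (((Finset.Ico 1 N).filter fun n : ℕ => (⌊c * n⌋).natAbs = m).card : ℝ) ≤ 1 / |c| + 1 := by
      refine card_le_of_forall_sub_le (by positivity) fun a ha b hb hab => ?_
      simp only [Finset.mem_filter, Finset.mem_Ico] at ha hb
      have e : ⌊c * a⌋ = ⌊c * b⌋ := by
        have ha1 : (1 : ℝ) ≤ a := by exact_mod_cast ha.1.1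
        have hb1 : (1 : ℝ) ≤ b := by exact_mod_cast hb.1.1
        rcases lt_or_gt_of_ne hc with h | h
        · have h2 : ⌊c * a⌋ < 0 := Int.floor_lt.2 (by push_cast; nlinarith)
          have h3 : ⌊c * b⌋ < 0 := Int.floor_lt.2 (by push_cast; nlinarith)
          omega
        · have h2 : 0 ≤ ⌊c * a⌋ := Int.floor_nonneg.2 (by positivity)
          have h3 : 0 ≤ ⌊c * b⌋ := Int.floor_nonneg.2 (by positivity)
          omega
      have h4 := Int.abs_sub_lt_one_of_floor_eq_floor e
      have h5 : |c * a - c * b| = |c| * (b - a) := by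
        have : (a : ℝ) ≤ b := by exact_mod_cast hab
        rw [← mul_sub, abs_mul, abs_sub_comm (a : ℝ), abs_of_nonneg (sub_nonneg.2 this)]
      rw [h5] at h4
      rw [le_div_iff₀ hc']
      linarith
    have h2 : ((⌈|c| * N⌉₊ + 1 : ℕ) : ℝ) ≤ (|c| + 2) * N := by
      have h3 := Nat.ceil_lt_add_one (show 0 ≤ |c| * N by positivity)
      have h4 : (1 : ℝ) ≤ N := by exact_mod_cast hN
      push_cast
      nlinarith
    calc _ ≤ (1 / |c| + 1) * ((|c| + 2) * N) := by gcongr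
      _ = _ := by ring

end Counting

/-! ### Bounded functions and uniform weak convergence on average -/

section Functions

variable {X : Type*} [MeasurableSpace X] {μ : Measure X}

/-- Bounded measurable functions. -/
def BddMeas (f : X → ℂ) : Prop := Measurable f ∧ ∃ C, ∀ x, ‖f x‖ ≤ C

lemma BddMeas.const (c : ℂ) : BddMeas fun _ : X => c := ⟨measurable_const, ‖c‖, fun _ => le_rfl⟩

lemma BddMeas.mul {f g : X → ℂ} (hf : BddMeas f) (hg : BddMeas g) :
    BddMeas fun x => f x * g x := by
  obtain ⟨hf, C, hC⟩ := hf
  obtain ⟨hg, D, hD⟩ := hg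
  refine ⟨hf.mul hg, C * D, fun x => ?_⟩
  rw [norm_mul]
  exact mul_le_mul (hC x) (hD x) (norm_nonneg _) ((norm_nonneg _).trans (hC x))

lemma BddMeas.sub {f g : X → ℂ} (hf : BddMeas f) (hg : BddMeas g) :
    BddMeas fun x => f x - g x := by
  obtain ⟨hf, C, hC⟩ := hf
  obtain ⟨hg, D, hD⟩ := hg
  exact ⟨hf.sub hg, C + D, fun x => (norm_sub_le _ _).trans (add_le_add (hC x) (hD x))⟩

lemma BddMeas.conj {f : X → ℂ} (hf : BddMeas f) : BddMeas fun x => (starRingEnd ℂ) (f x) := by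
  obtain ⟨hf, C, hC⟩ := hf
  exact ⟨Complex.continuous_conj.measurable.comp hf, C, fun x => by simpa using hC x⟩

lemma BddMeas.comp {f : X → ℂ} (hf : BddMeas f) {Y : Type*} [MeasurableSpace Y] {T : Y → X}
    (hT : Measurable T) : BddMeas fun x => f (T x) := by
  obtain ⟨hf, C, hC⟩ := hf
  exact ⟨hf.comp hT, C, fun x => hC _⟩

lemma BddMeas.prod {κ : Type*} (s : Finset κ) {f : κ → X → ℂ} (hf : ∀ k ∈ s, BddMeas (f k)) :
    BddMeas fun x => ∏ k ∈ s, f k x := by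
  classical
  induction s using Finset.induction_on with
  | empty => simpa using BddMeas.const 1
  | insert a s ha ih =>
    simpa [Finset.prod_insert ha] using (hf a (by simp)).mul (ih fun k hk => hf k (by simp [hk]))

lemma BddMeas.memLp [IsFiniteMeasure μ] {f : X → ℂ} (hf : BddMeas f) (p : ℝ≥0∞) : MemLp f p μ := by
  obtain ⟨hf, C, hC⟩ := hf
  exact MemLp.of_bound hf.aestronglyMeasurable C (.of_forall hC)

lemma BddMeas.integrable [IsFiniteMeasure μ] {f : X → ℂ} (hf : BddMeas f) : Integrable f μ :=
  memLp_one_iff_integrable.1 (hf.memLp 1)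

lemma exists_common_bound {κ : Type*} [Finite κ] {f : κ → X → ℂ} (hf : ∀ k, BddMeas (f k)) :
    ∃ C, 1 ≤ C ∧ ∀ k x, ‖f k x‖ ≤ C := by
  choose C hC using fun k => (hf k).2
  obtain ⟨D, hD⟩ := (Set.finite_range C).bddAbove
  exact ⟨max 1 D, le_max_left _ _, fun k x =>
    (hC k x).trans ((hD ⟨k, rfl⟩).trans (le_max_right _ _))⟩

lemma norm_prod_le_pow {κ : Type*} [Fintype κ] {a : κ → ℂ} {C : ℝ} (h : ∀ k, ‖a k‖ ≤ C) :
    ‖∏ k, a k‖ ≤ C ^ Fintype.card κ := by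
  rw [norm_prod]
  refine (Finset.prod_le_prod (fun _ _ => norm_nonneg _) fun k _ => h k).trans ?_
  simp

lemma norm_integral_le_of_bound [IsProbabilityMeasure μ] {f : X → ℂ} {C : ℝ}
    (h : ∀ x, ‖f x‖ ≤ C) : ‖∫ x, f x ∂μ‖ ≤ C := by
  simpa using norm_integral_le_of_norm_le_const (μ := μ) (.of_forall h)

/-- Averages of `|∫ F u n|` tend to zero uniformly over `F` bounded by one. -/
def UNull (μ : Measure X) (u : ℕ → X → ℂ) : Prop :=
  ∀ ε > 0, ∀ᶠ N : ℕ in atTop, ∀ F : X → ℂ, Measurable F → (∀ x, ‖F x‖ ≤ 1) →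
    ∑ n ∈ Finset.range N, ‖∫ x, F x * u n x ∂μ‖ ≤ ε * N

lemma UNull.cesNull {u : ℕ → X → ℂ} (hu : UNull μ u) {F : X → ℂ} (hF : BddMeas F) :
    CesNull fun n => ‖∫ x, F x * u n x ∂μ‖ := by
  obtain ⟨hF, C, hC⟩ := hF
  set D := max C 1
  have hD : 0 < D := lt_of_lt_of_le one_pos (le_max_right _ _)
  intro ε hε
  filter_upwards [hu (ε / D) (by positivity)] with N hN
  have h1 := hN (fun x => (D⁻¹ : ℝ) * F x) (by fun_prop) fun x => by
    rw [norm_mul, Complex.norm_real, Real.norm_of_nonneg (by positivity), inv_mul_le_iff₀ hD]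
    linarith [hC x, le_max_left C 1]
  simp_rw [mul_assoc, integral_const_mul, norm_mul, ← Finset.mul_sum] at h1
  rw [Complex.norm_real, Real.norm_of_nonneg (by positivity), inv_mul_le_iff₀ hD] at h1
  calc _ ≤ _ := h1
    _ = _ := by field_simp

lemma UNull.of_comp [IsProbabilityMeasure μ] {κ : Type*} (s : Finset κ) {U : κ → ℕ → X → ℂ}
    (hU : ∀ e ∈ s, UNull μ (U e)) {τ : ℕ → ℕ} (hτ : EvenlySpread τ) {u : ℕ → X → ℂ} {B : ℝ}
    (hB : ∀ n x, ‖u n x‖ ≤ B) (h : ∀ᶠ n in atTop, ∃ e ∈ s, u n = U e (τ n)) : UNull μ u := by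
  obtain ⟨C, n₀, hC, hsum⟩ := hτ.eventually_sum_le
  obtain ⟨n₁, hn₁⟩ := eventually_atTop.1 h
  intro ε hε
  set δ := ε / (2 * (C * s.card + 1)) with hδ
  have hδ0 : 0 < δ := by positivity
  obtain ⟨N₀, hN₀⟩ := eventually_atTop.1 ((Finset.eventually_all s).2 fun e he => hU e he δ hδ0)
  obtain ⟨M, hM⟩ := hsum δ hδ0 N₀
  have h1 : ∀ᶠ N : ℕ in atTop, (max n₀ n₁ : ℕ) * B ≤ ε / 2 * N :=
    ((tendsto_natCast_atTop_atTop (R := ℝ)).const_mul_atTop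
      (show 0 < ε / 2 by positivity)).eventually_ge_atTop _
  filter_upwards [hM, h1, eventually_ge_atTop (max n₀ n₁)] with N ⟨h2, h3⟩ h4 h5 F hF hF1
  set a : ℕ → ℝ := fun n => ‖∫ x, F x * u n x ∂μ‖
  set A : κ → ℕ → ℝ := fun e m => ‖∫ x, F x * U e m x ∂μ‖
  have haB : ∀ n, a n ≤ B := fun n => norm_integral_le_of_bound fun x => by
    rw [norm_mul]
    calc _ ≤ 1 * B := mul_le_mul (hF1 x) (hB n x) (norm_nonneg _) zero_le_one
      _ = B := one_mul B
  have hA : ∀ n ≥ n₁, a n ≤ ∑ e ∈ s, A e (τ n) := fun n hn => by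
    obtain ⟨e, he, hue⟩ := hn₁ n hn
    have : a n = A e (τ n) := by simp only [a, A, hue]
    rw [this]
    exact Finset.single_le_sum (f := fun e => A e (τ n)) (fun _ _ => norm_nonneg _) he
  rw [← Finset.sum_range_add_sum_Ico _ h5]
  have h6 : ∑ n ∈ Finset.range (max n₀ n₁), a n ≤ ε / 2 * N :=
    (Finset.sum_le_sum fun n _ => haB n).trans (by simpa using h4)
  have h7 : ∑ n ∈ Finset.Ico (max n₀ n₁) N, a n ≤ ε / 2 * N := by
    calc _ ≤ ∑ n ∈ Finset.Ico (max n₀ n₁) N, ∑ e ∈ s, A e (τ n) :=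
          Finset.sum_le_sum fun n hn => hA n ((le_max_right _ _).trans (Finset.mem_Ico.1 hn).1)
      _ ≤ ∑ n ∈ Finset.Ico n₀ N, ∑ e ∈ s, A e (τ n) :=
          Finset.sum_le_sum_of_subset_of_nonneg
            (Finset.Ico_subset_Ico_left (le_max_left _ _))
            fun _ _ _ => Finset.sum_nonneg fun _ _ => norm_nonneg _
      _ = ∑ e ∈ s, ∑ n ∈ Finset.Ico n₀ N, A e (τ n) := Finset.sum_comm
      _ ≤ ∑ e ∈ s, C * δ * N := Finset.sum_le_sum fun e he =>
          h3 (A e) (fun _ => norm_nonneg _) (hN₀ _ h2 e he F hF hF1)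
      _ = (C * s.card) * δ * N := by rw [Finset.sum_const, nsmul_eq_mul]; ring
      _ ≤ ε / 2 * N := by
          gcongr
          rw [hδ, mul_div_assoc', div_le_div_iff₀ (by positivity) (by positivity)]
          nlinarith
  linarith

lemma inner_toLp {f g : X → ℂ} (hf : MemLp f 2 μ) (hg : MemLp g 2 μ) :
    inner ℂ (hf.toLp f) (hg.toLp g) = ∫ x, (starRingEnd ℂ) (f x) * g x ∂μ := by
  rw [L2.inner_def]
  refine integral_congr_ae ?_
  filter_upwards [hf.coeFn_toLp, hg.coeFn_toLp] with x h1 h2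
  rw [h1, h2]
  simp [mul_comm]

lemma norm_toLp_le_of_bound [IsProbabilityMeasure μ] {f : X → ℂ} (hf : MemLp f 2 μ) {C : ℝ}
    (hC : 0 ≤ C) (h : ∀ x, ‖f x‖ ≤ C) : ‖hf.toLp f‖ ≤ C := by
  refine (Lp.norm_le_of_ae_bound hC ?_).trans_eq (by simp [measureUnivNNReal])
  filter_upwards [hf.coeFn_toLp] with x hx
  rw [hx]; exact h x

/-- This is `vdC_uniform` in L²: the integral of F u is the inner product with the conjugate of F.
-/
lemma UNull.of_corr [IsProbabilityMeasure μ] {u : ℕ → X → ℂ} {B : ℝ} (hm : ∀ n, Measurable (u n))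
    (hB : ∀ n x, ‖u n x‖ ≤ B) {γ : ℕ → ℝ} (hγ : CesNull γ) {z : ℕ → ℕ → ℝ}
    (hz : ∀ h, CesNull (z h))
    (hcorr : ∀ h, ∀ᶠ n in atTop,
      ‖∫ x, u (n + h) x * (starRingEnd ℂ) (u n x) ∂μ‖ ≤ γ h + z h n) : UNull μ u := by
  have hL : ∀ n, MemLp (u n) 2 μ := fun n => BddMeas.memLp ⟨hm n, B, hB n⟩ 2
  have hB' : ∀ n x, ‖u n x‖ ≤ max B 0 := fun n x => (hB n x).trans (le_max_left _ _)
  intro ε hε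
  have := vdC_uniform (u := fun n => (hL n).toLp (u n)) (B := max B 0)
    (fun n => norm_toLp_le_of_bound _ (le_max_right _ _) (hB' n)) hγ hz (fun h => by
      filter_upwards [hcorr h] with n hn
      rw [inner_toLp, ← RCLike.norm_conj, ← integral_conj]
      simpa using hn) hε
  filter_upwards [this] with N hN F hF hF1
  have hFL : MemLp (fun x => (starRingEnd ℂ) (F x)) 2 μ :=
    (BddMeas.conj ⟨hF, 1, hF1⟩).memLp 2
  have := hN (hFL.toLp _) (norm_toLp_le_of_bound _ zero_le_one fun x => by simpa using hF1 x)
  simpa [inner_toLp] using this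

end Functions

/-! ### Multiple averages for measure preserving group actions -/

section Action

variable {X : Type*} [MeasurableSpace X] {μ : Measure X} {G : Type*} [AddCommGroup G]

/-- A measure preserving action of an additive commutative group. -/
structure PreservingAction (μ : Measure X) (act : G → X → X) : Prop where
  zero : ∀ x, act 0 x = x
  add : ∀ a b x, act (a + b) x = act a (act b x)
  mp : ∀ a, MeasurePreserving (act a) μ μ

variable {act : G → X → X}

lemma PreservingAction.integral_comp (ha : PreservingAction μ act) (g : G) {f : X → ℂ}
    (hf : BddMeas f) : ∫ x, f (act g x) ∂μ = ∫ x, f x ∂μ := by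
  conv_rhs => rw [← (ha.mp g).map_eq]
  rw [integral_map (ha.mp g).measurable.aemeasurable hf.1.aestronglyMeasurable]

lemma PreservingAction.bddMeas_comp (ha : PreservingAction μ act) (g : G) {f : X → ℂ}
    (hf : BddMeas f) : BddMeas fun x => f (act g x) := hf.comp (ha.mp g).measurable

lemma PreservingAction.bddMeas_prod (ha : PreservingAction μ act) {ι : Type*} [Fintype ι]
    (b : ι → G) {f : ι → X → ℂ} (hf : ∀ q, BddMeas (f q)) :
    BddMeas fun x => ∏ q, f q (act (b q) x) :=
  .prod _ fun q _ => ha.bddMeas_comp (b q) (hf q)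

/-- Multiple averages along `b` tend to zero when the function with index `k` has mean zero. -/
def NormGood (μ : Measure X) (act : G → X → X) {ι : Type} [Fintype ι] (b : ι → ℕ → G) (k : ι) :
    Prop :=
  ∀ f : ι → X → ℂ, (∀ q, BddMeas (f q)) → ∫ x, f k x ∂μ = 0 →
    UNull μ fun n x => ∏ q, f q (act (b q n) x)

/-- Multiple correlations along `b` tend to zero in the sense of Cesàro when the function with
index `k` has mean zero. -/
def ScalarGood (μ : Measure X) (act : G → X → X) {ι : Type} [Fintype ι] (b : ι → ℕ → G) (k : ι) :
    Prop :=
  ∀ f : ι → X → ℂ, (∀ q, BddMeas (f q)) → ∫ x, f k x ∂μ = 0 →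
    CesNull fun n => ‖∫ x, ∏ q, f q (act (b q n) x) ∂μ‖

variable {ι : Type} [Fintype ι]

/-- An error in a finite set replaces the functions by finitely many families of translates, and a
translate of a mean zero function still has mean zero. -/
lemma NormGood.of_comp [IsProbabilityMeasure μ] (ha : PreservingAction μ act) {b b' : ι → ℕ → G}
    {k : ι} (hb : NormGood μ act b k) {τ : ℕ → ℕ} (hτ : EvenlySpread τ) {E : Set G}
    (hE : E.Finite) (h : ∀ᶠ n in atTop, ∀ q, b' q n - b q (τ n) ∈ E) : NormGood μ act b' k := by
  classical
  intro f hf hk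
  obtain ⟨C, hC1, hC⟩ := exists_common_bound hf
  refine UNull.of_comp (Fintype.piFinset fun _ : ι => hE.toFinset)
    (U := fun e n x => ∏ q, f q (act (e q) (act (b q n) x))) (fun e _ => ?_) hτ
    (fun n x => norm_prod_le_pow fun q => hC q _) ?_
  · exact hb (fun q x => f q (act (e q) x)) (fun q => ha.bddMeas_comp _ (hf q))
      (by rw [ha.integral_comp _ (hf k), hk])
  · filter_upwards [h] with n hn
    refine ⟨fun q => b' q n - b q (τ n), by simpa using hn, ?_⟩
    funext x
    exact Finset.prod_congr rfl fun q _ => by rw [← ha.add, sub_add_cancel]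

lemma ScalarGood.perturb (ha : PreservingAction μ act) {b b' : ι → ℕ → G}
    {k : ι} (hb : ScalarGood μ act b k) {E : Set G}
    (hE : E.Finite) (h : ∀ᶠ n in atTop, ∀ q, b' q n - b q n ∈ E) : ScalarGood μ act b' k := by
  classical
  intro f hf hk
  have h1 : CesNull fun n => ∑ e ∈ Fintype.piFinset fun _ : ι => hE.toFinset,
      ‖∫ x, ∏ q, f q (act (e q) (act (b q n) x)) ∂μ‖ :=
    .sum _ fun e _ => hb (fun q x => f q (act (e q) x)) (fun q => ha.bddMeas_comp _ (hf q))
      (by rw [ha.integral_comp _ (hf k), hk])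
  refine h1.mono_eventually ?_
  filter_upwards [h] with n hn
  have h2 : ∀ x, ∏ q, f q (act (b' q n) x) =
      ∏ q, f q (act ((fun q => b' q n - b q n) q) (act (b q n) x)) := fun x =>
    Finset.prod_congr rfl fun q _ => by rw [← ha.add, sub_add_cancel]
  simp_rw [h2]
  exact Finset.single_le_sum
    (f := fun e : ι → G => ‖∫ x, ∏ q, f q (act (e q) (act (b q n) x)) ∂μ‖)
    (fun _ _ => norm_nonneg _) (by simpa using hn)

/-- Translating so that the functions with indices in `P` stay fixed. -/
lemma ScalarGood.of_normGood [IsProbabilityMeasure μ] (ha : PreservingAction μ act)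
    {b : ι → ℕ → G} {k : ι} (c : ℕ → G) (P : ι → Prop) [DecidablePred P] (hk : ¬ P k)
    (hP : ∀ q, P q → ∀ n, b q n = c n)
    (h : NormGood μ act (fun (q : {q // ¬ P q}) n => b q n - c n) ⟨k, hk⟩) :
    ScalarGood μ act b k := by
  intro f hf hk0
  -- After translation by −c n, the factors with index in P no longer depend on n; their product is
  -- the test function.
  have h1 := (h (fun q => f q) (fun q => hf q) hk0).cesNull
    (F := fun x => ∏ q : {q // P q}, f q (act 0 x)) (ha.bddMeas_prod _ fun q => hf q)
  refine h1.mono fun n => le_of_eq ?_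
  rw [← ha.integral_comp (-c n) (ha.bddMeas_prod (fun q => b q n) hf)]
  congr 2
  funext x
  rw [← Fintype.prod_subtype_mul_prod_subtype P]
  congr 1
  · exact Finset.prod_congr rfl fun q _ => by rw [← ha.add, hP q q.2, add_neg_cancel]
  · exact Finset.prod_congr rfl fun q _ => by
      simp only [← ha.add, sub_eq_add_neg]

/-- Van der Corput: correlating the product with its shift by h gives a multiple correlation along
the doubled family, with conjugates on the unshifted copy. The finitely many h below the threshold
are bounded trivially and do not affect the Cesàro average over h. -/
lemma NormGood.of_scalarGood [IsProbabilityMeasure μ] (ha : PreservingAction μ act)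
    {r : ι → ℕ → G} {k : ι}
    (h : ∀ᶠ h in atTop, ScalarGood μ act
      (fun (q : ι × Bool) n => if q.2 then r q.1 (n + h) else r q.1 n) (k, true)) :
    NormGood μ act r k := by
  classical
  intro f hf hk
  obtain ⟨C, hC1, hC⟩ := exists_common_bound hf
  set B := C ^ Fintype.card ι
  have hB : ∀ n x, ‖∏ q, f q (act (r q n) x)‖ ≤ B := fun n x => norm_prod_le_pow fun q => hC q _
  have hB0 : 0 ≤ B := by positivity
  obtain ⟨h₀, hh₀⟩ := eventually_atTop.1 h
  refine UNull.of_corr (B := B) (γ := fun h => if h < h₀ then B * B else 0)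
    (z := fun h n => if h < h₀ then 0 else
      ‖∫ x, (∏ q, f q (act (r q (n + h)) x)) * (starRingEnd ℂ) (∏ q, f q (act (r q n) x)) ∂μ‖)
    (fun n => (ha.bddMeas_prod _ hf).1) hB ?_ ?_ ?_
  · refine .of_eventually_zero ?_
    filter_upwards [eventually_ge_atTop h₀] with h hh
    simp [hh]
  · intro h
    by_cases hh : h < h₀
    · simpa [hh] using CesNull.zero
    simp only [hh, if_false]
    have := hh₀ h (not_lt.1 hh)
      (fun q => if q.2 then f q.1 else fun x => (starRingEnd ℂ) (f q.1 x)) (by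
        rintro ⟨q, _ | _⟩
        · exact (hf q).conj
        · exact hf q) (by simpa using hk)
    refine this.mono fun n => le_of_eq ?_
    congr 2
    funext x
    rw [Fintype.prod_prod_type]
    simp [Finset.prod_mul_distrib]
  · intro h
    by_cases hh : h < h₀
    · refine .of_forall fun n => ?_
      simp only [hh, if_true, add_zero]
      refine norm_integral_le_of_bound fun x => ?_
      rw [norm_mul, RCLike.norm_conj]
      exact mul_le_mul (hB _ x) (hB _ x) (norm_nonneg _) hB0
    · simp [hh]

/-- Correlations of a mean zero function along the multiples of `e` are small on average. -/
def MixingAlong (μ : Measure X) (act : G → X → X) (e : G) : Prop :=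
  ∀ f f' : X → ℂ, BddMeas f → BddMeas f' → ∫ x, f x ∂μ = 0 → ∀ c : ℝ, c ≠ 0 →
    CesNull fun h : ℕ => ‖∫ x, f (act (⌊c * h⌋ • e) x) * f' x ∂μ‖

/-- Multilinearity in the factor k, split into its mean and its mean zero part. The mean multiplies
fewer than `card ι` factors, so 1 ≤ C is needed for the stated power. -/
lemma norm_integral_prod_le_update [DecidableEq ι] [IsProbabilityMeasure μ]
    (ha : PreservingAction μ act) {F : ι → X → ℂ} (hF : ∀ q, BddMeas (F q)) {C : ℝ} (hC1 : 1 ≤ C)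
    (hC : ∀ q x, ‖F q x‖ ≤ C) (b : ι → G) (k : ι) :
    ‖∫ x, ∏ q, F q (act (b q) x) ∂μ‖ ≤
      C ^ Fintype.card ι * ‖∫ x, F k x ∂μ‖ + ‖∫ x, ∏ q, Function.update F k
        (fun x => F k x - ∫ y, F k y ∂μ) q (act (b q) x) ∂μ‖ := by
  set m := ∫ x, F k x ∂μ
  have hU : ∀ (φ : X → ℂ), BddMeas φ → BddMeas fun x =>
      ∏ q, Function.update F k φ q (act (b q) x) := fun φ hφ =>
    ha.bddMeas_prod b fun q => by
      rcases eq_or_ne q k with rfl | h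
      · simpa using hφ
      · simpa [h] using hF q
  have hsplit : ∀ (φ : X → ℂ) x, ∏ q, Function.update F k φ q (act (b q) x) =
      φ (act (b k) x) * ∏ q ∈ Finset.univ.erase k, F q (act (b q) x) := fun φ x => by
    rw [← Finset.mul_prod_erase _ _ (Finset.mem_univ k)]
    congr 1
    · simp
    · exact Finset.prod_congr rfl fun q hq => by
        rw [Function.update_of_ne (Finset.ne_of_mem_erase hq)]
  have e : ∀ x, ∏ q, F q (act (b q) x) =
      ∏ q, Function.update F k (fun _ => m) q (act (b q) x) +
      ∏ q, Function.update F k (fun x => F k x - m) q (act (b q) x) := fun x => by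
    have := hsplit (F k) x
    rw [Function.update_eq_self] at this
    rw [this, hsplit, hsplit]
    ring
  simp_rw [e]
  rw [integral_add (hU _ (.const m)).integrable (hU _ ((hF k).sub (.const m))).integrable]
  refine (norm_add_le _ _).trans (add_le_add_left ?_ _)
  refine norm_integral_le_of_bound fun x => ?_
  rw [hsplit, norm_mul, mul_comm]
  gcongr
  rw [norm_prod]
  refine (Finset.prod_le_prod (fun _ _ => norm_nonneg _) fun q _ => hC q _).trans ?_
  rw [Finset.prod_const]
  exact pow_le_pow_right₀ hC1 (Finset.card_le_univ _)

/-- The case of sequences that are, up to bounded errors, linear in the mixing direction and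
constant in the others. -/
lemma normGood_of_almost_linear [IsProbabilityMeasure μ] (ha : PreservingAction μ act) {e : G}
    (he : MixingAlong μ act e) (b : ι → ℕ → G) (k : ι) (c : ι → ℝ) (hck : c k ≠ 0)
    (hc : ∀ q, q ≠ k → c q ≠ c k) {D : Set G} (hD : D.Finite)
    (hb : ∀ h : ℕ, ∀ᶠ n in atTop, ∀ q, b q (n + h) - b q n - ⌊c q * h⌋ • e ∈ D) :
    NormGood μ act b k := by
  classical
  induction hι : Fintype.card ι generalizing ι D with
  | zero => exact absurd hι (Fintype.card_pos_iff.2 ⟨k⟩).ne'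
  | succ s ih =>
    -- For scalar correlations one member p ≠ k can be translated away, which leaves a smaller
    -- family with slopes c q − c p; these still satisfy the hypotheses at k. A lone factor k has
    -- integral zero.
    have hS : ScalarGood μ act b k := by
      by_cases hex : ∃ p, p ≠ k
      · obtain ⟨p, hp⟩ := hex
        refine ScalarGood.of_normGood ha (b p) (fun q => q = p) hp.symm
          (fun q hq n => by rw [hq]) ?_
        refine ih (ι := {q // ¬ q = p}) (fun q n => b q n - b p n) ⟨k, hp.symm⟩ (fun q => c q - c p)
          (sub_ne_zero.2 (hc p hp).symm) (fun q hq => ?_)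
          -- Differences of errors, plus the rounding ⌊x⌋ − ⌊y⌋ − ⌊x − y⌋, an integer strictly
          -- between −2 and 2.
          (D := (fun t : G × G × ℤ => t.1 - t.2.1 + t.2.2 • e) '' (D ×ˢ D ×ˢ Set.Icc (-1) 1))
          ((hD.prod (hD.prod (Set.finite_Icc _ _))).image _) (fun h => ?_) ?_
        · have := hc q fun h => hq (Subtype.ext h)
          simpa using this
        · filter_upwards [hb h] with n hn q
          refine ⟨(_, _, ⌊c q * h⌋ - ⌊c p * h⌋ - ⌊(c q - c p) * h⌋), ⟨hn q, hn p, ?_⟩, ?_⟩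
          · have h1 := Int.floor_le (c q * h)
            have h2 := Int.lt_floor_add_one (c q * h)
            have h3 := Int.floor_le (c p * h)
            have h4 := Int.lt_floor_add_one (c p * h)
            have h5 := Int.floor_le ((c q - c p) * h)
            have h6 := Int.lt_floor_add_one ((c q - c p) * h)
            have h7 : (c q - c p) * h = c q * h - c p * h := by ring
            constructor
            · have : ((-2 : ℤ) : ℝ) < ((⌊c q * h⌋ - ⌊c p * h⌋ - ⌊(c q - c p) * h⌋ : ℤ) : ℝ) := by
                push_cast; linarith
              have := Int.cast_lt.1 this
              dsimp only
              omega
            · have : ((⌊c q * h⌋ - ⌊c p * h⌋ - ⌊(c q - c p) * h⌋ : ℤ) : ℝ) < ((2 : ℤ) : ℝ) := by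
                push_cast; linarith
              have := Int.cast_lt.1 this
              dsimp only
              omega
          · simp only [sub_smul]
            abel
        · rw [Fintype.card_subtype_compl, hι]
          simp
      · push Not at hex
        intro f hf hk
        have : ∀ n, ‖∫ x, ∏ q, f q (act (b q n) x) ∂μ‖ = 0 := fun n => by
          have hu : (Finset.univ : Finset ι) = {k} := by
            ext q; simp [hex q]
          simp_rw [hu, Finset.prod_singleton]
          rw [ha.integral_comp _ (hf k), hk, norm_zero]
        simp_rw [this]
        exact CesNull.zero
    intro f hf hk
    obtain ⟨C, hC1, hC⟩ := exists_common_bound hf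
    -- With δ the actual error, the correlation at shift h is the multiple correlation of the
    -- functions F h δ along b itself.
    set F : ℕ → (ι → G) → ι → X → ℂ := fun h δ q x =>
      f q (act (δ q) (act (⌊c q * h⌋ • e) x)) * (starRingEnd ℂ) (f q x) with hFdef
    have hF : ∀ h δ q, BddMeas (F h δ q) := fun h δ q =>
      (ha.bddMeas_comp (⌊c q * h⌋ • e) (ha.bddMeas_comp (δ q) (hf q))).mul (hf q).conj
    have hFC : ∀ h δ q x, ‖F h δ q x‖ ≤ C * C := fun h δ q x => by
      rw [hFdef, norm_mul, RCLike.norm_conj]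
      exact mul_le_mul (hC _ _) (hC _ _) (norm_nonneg _) (by linarith)
    set Δ := Fintype.piFinset fun _ : ι => hD.toFinset
    -- The mean of F h δ k depends only on h and is small on average by mixing along e: this is γ.
    -- Once it is subtracted, `hS` applies for each fixed h: this is z. Both are summed over the
    -- finitely many possible δ.
    refine UNull.of_corr (B := C ^ Fintype.card ι)
      (γ := fun h => ∑ δ ∈ Δ, (C * C) ^ Fintype.card ι * ‖∫ x, F h δ k x ∂μ‖)
      (z := fun h n => ∑ δ ∈ Δ, ‖∫ x, ∏ q, Function.update (F h δ) k
        (fun x => F h δ k x - ∫ y, F h δ k y ∂μ) q (act (b q n) x) ∂μ‖)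
      (fun n => (ha.bddMeas_prod _ hf).1) (fun n x => norm_prod_le_pow fun q => hC q _) ?_ ?_ ?_
    · refine .sum _ fun δ _ => .const_mul ?_ (by positivity)
      exact he (fun x => f k (act (δ k) x)) _ (ha.bddMeas_comp _ (hf k)) (hf k).conj
        (by rw [ha.integral_comp _ (hf k), hk]) (c k) hck
    · intro h
      refine .sum _ fun δ _ => hS _ (fun q => ?_) ?_
      · rcases eq_or_ne q k with rfl | hq
        · simpa using (hF h δ q).sub (.const _)
        · simpa [hq] using hF h δ q
      · simp only [Function.update_self]
        rw [integral_sub (hF h δ k).integrable (BddMeas.const _).integrable]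
        simp
    · intro h
      filter_upwards [hb h] with n hn
      rw [← Finset.sum_add_distrib]
      set δ : ι → G := fun q => b q (n + h) - b q n - ⌊c q * h⌋ • e
      have hδ : δ ∈ Δ := by simpa [Δ] using hn
      have key := norm_integral_prod_le_update ha (hF h δ) (one_le_mul_of_one_le_of_one_le hC1 hC1)
        (hFC h δ) (fun q => b q n) k
      refine le_trans (le_of_eq ?_) (key.trans (Finset.single_le_sum
        (f := fun δ => (C * C) ^ Fintype.card ι * ‖∫ x, F h δ k x ∂μ‖ +
          ‖∫ x, ∏ q, Function.update (F h δ) k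
        (fun x => F h δ k x - ∫ y, F h δ k y ∂μ) q (act (b q n) x) ∂μ‖)
        (fun _ _ => by positivity) hδ))
      congr 2
      funext x
      rw [map_prod, ← Finset.prod_mul_distrib]
      refine Finset.prod_congr rfl fun q _ => ?_
      rw [hFdef]
      simp only [← ha.add]
      congr 3
      simp only [δ]
      abel

end Action

/-! ### From ergodicity of T × T to decay of correlations -/

section WeakMixing

variable {X : Type*} [MeasurableSpace X] {μ : Measure X} [IsProbabilityMeasure μ]

/-- Von Neumann's mean ergodic theorem: by ergodicity the invariant functions are constant, and Φ is
orthogonal to constants. -/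
lemma tendsto_average_corr_of_ergodic {S : X → X} (hS : Ergodic S μ) {Φ Ψ : X → ℂ}
    (hΦ : BddMeas Φ) (hΨ : BddMeas Ψ) (h0 : ∫ x, Φ x ∂μ = 0) :
    Tendsto (fun N : ℕ => (N : ℂ)⁻¹ * ∑ n ∈ Finset.range N, ∫ x, Φ (S^[n] x) * Ψ x ∂μ)
      atTop (𝓝 0) := by
  have hmp := hS.toMeasurePreserving
  have hL : MemLp Φ 2 μ := hΦ.memLp 2
  have hR : MemLp (fun x => (starRingEnd ℂ) (Ψ x)) 2 μ := hΨ.conj.memLp 2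
  set U := (Lp.compMeasurePreservingₗᵢ (E := ℂ) (p := 2) ℂ S hmp).toContinuousLinearMap
  have hU : ∀ y, U y = Lp.compMeasurePreserving S hmp y := fun _ => rfl
  have hit : ∀ n, U^[n] (hL.toLp Φ) =
      (hL.comp_measurePreserving (hmp.iterate n)).toLp (Φ ∘ S^[n]) := fun n => by
    have : (U : Lp ℂ 2 μ → Lp ℂ 2 μ) = Lp.compMeasurePreserving S hmp := funext hU
    rw [this, Lp.compMeasurePreserving_iterate, Lp.toLp_compMeasurePreserving]
  have hproj : (U.eqLocus (1 : Lp ℂ 2 μ →L[ℂ] Lp ℂ 2 μ)).orthogonalProjectionOnto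
      (hL.toLp Φ) = 0 := by
    rw [Submodule.orthogonalProjectionOnto_eq_zero_iff, Submodule.mem_orthogonal]
    intro y hy
    have hy' : U y = y := hy
    have hinv : (y : X → ℂ) ∘ S =ᵐ[μ] y := by
      refine (Lp.coeFn_compMeasurePreserving y hmp).symm.trans ?_
      rw [← hU, hy']
    obtain ⟨c, hc⟩ := hS.quasiErgodic.ae_eq_const_of_ae_eq_comp_ae
      (Lp.aestronglyMeasurable y) hinv
    rw [L2.inner_def]
    calc _ = ∫ x, (starRingEnd ℂ) c * Φ x ∂μ := by
          refine integral_congr_ae ?_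
          filter_upwards [hc, hL.coeFn_toLp] with x h1 h2
          rw [h1, h2]
          simp [mul_comm]
      _ = 0 := by rw [integral_const_mul, h0, mul_zero]
  have hlim := U.tendsto_birkhoffAverage_orthogonalProjection
    (LinearIsometry.norm_toContinuousLinearMap_le _) (hL.toLp Φ)
  rw [hproj] at hlim
  have h1 := ((continuous_const (y := hR.toLp _)).inner (𝕜 := ℂ) continuous_id).tendsto
    (0 : Lp ℂ 2 μ) |>.comp hlim
  simp only [id, inner_zero_right] at h1
  refine h1.congr fun N => ?_
  simp only [Function.comp, birkhoffAverage, birkhoffSum, id, inner_smul_right, inner_sum, hit,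
    inner_toLp, RingHomCompTriple.comp_apply, RingHom.id_apply]
  simp [mul_comm]

/-- By Fubini the correlations of f ⊗ f̄ and f' ⊗ f̄' in the product system are the squares |∫ f∘Tⁿ
· f'|². -/
lemma cesNull_corr_of_ergodic_prod {T : X → X}
    (hE : Ergodic (Prod.map T T) (μ.prod μ)) {f f' : X → ℂ} (hf : BddMeas f) (hf' : BddMeas f')
    (h0 : ∫ x, f x ∂μ = 0) : CesNull fun n => ‖∫ x, f (T^[n] x) * f' x ∂μ‖ := by
  have hΦ : BddMeas fun z : X × X => f z.1 * (starRingEnd ℂ) (f z.2) :=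
    (hf.comp measurable_fst).mul (hf.conj.comp measurable_snd)
  have hΨ : BddMeas fun z : X × X => f' z.1 * (starRingEnd ℂ) (f' z.2) :=
    (hf'.comp measurable_fst).mul (hf'.conj.comp measurable_snd)
  have hlim := tendsto_average_corr_of_ergodic hE hΦ hΨ (by
    rw [integral_prod_mul f fun x => (starRingEnd ℂ) (f x), h0, zero_mul])
  have hval : ∀ n, ∫ z, (f ((Prod.map T T)^[n] z).1 * (starRingEnd ℂ) (f ((Prod.map T T)^[n] z).2))
      * (f' z.1 * (starRingEnd ℂ) (f' z.2)) ∂(μ.prod μ)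
      = ((‖∫ x, f (T^[n] x) * f' x ∂μ‖ ^ 2 : ℝ) : ℂ) := fun n => by
    have e : ∀ z : X × X, (f ((Prod.map T T)^[n] z).1 *
        (starRingEnd ℂ) (f ((Prod.map T T)^[n] z).2)) * (f' z.1 * (starRingEnd ℂ) (f' z.2)) =
        (f (T^[n] z.1) * f' z.1) * (starRingEnd ℂ) (f (T^[n] z.2) * f' z.2) := fun z => by
      rw [Prod.map_iterate, map_mul]
      simp only [Prod.map_fst, Prod.map_snd]
      ring
    simp_rw [e]
    rw [integral_prod_mul (fun x => f (T^[n] x) * f' x)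
      fun x => (starRingEnd ℂ) (f (T^[n] x) * f' x), integral_conj, Complex.mul_conj,
      Complex.normSq_eq_norm_sq]
  simp_rw [hval] at hlim
  refine CesNull.of_sq fun ε hε => ?_
  filter_upwards [Metric.tendsto_atTop'.1 hlim ε hε |> fun ⟨N₀, h⟩ => eventually_gt_atTop N₀ |>.mono h,
    eventually_gt_atTop 0] with N hN hN0
  have hN' : (0 : ℝ) < N := by exact_mod_cast hN0
  rw [dist_zero_right, ← Complex.ofReal_sum, norm_mul, norm_inv, Complex.norm_natCast,
    Complex.norm_real, Real.norm_of_nonneg (by positivity), inv_mul_lt_iff₀ hN'] at hN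
  linarith

lemma MixingAlong.of_ergodic_prod {G : Type*} [AddCommGroup G] {act : G → X → X}
    (ha : PreservingAction μ act) {e : G}
    (he : Ergodic (Prod.map (act e) (act e)) (μ.prod μ)) : MixingAlong μ act e := by
  have hit : ∀ (n : ℕ) x, act (n • e) x = (act e)^[n] x := fun n => by
    induction n with
    | zero => intro x; simpa using ha.zero x
    | succ n ih => intro x; rw [add_smul, one_smul, ha.add, ih, Function.iterate_succ_apply]
  intro f f' hf hf' h0 c hc
  set m := ∫ x, f' x ∂μ
  set x₁ : ℕ → ℝ := fun n => ‖∫ x, f ((act e)^[n] x) * f' x ∂μ‖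
  -- For negative times, ∫ f∘T⁻ⁿ · f' = ∫ f'∘Tⁿ · f. Subtracting the mean of f' changes nothing, as
  -- f has mean zero.
  set x₂ : ℕ → ℝ := fun n => ‖∫ x, (f' ((act e)^[n] x) - m) * f x ∂μ‖
  have h1 : CesNull x₁ := cesNull_corr_of_ergodic_prod he hf hf' h0
  have hs : BddMeas fun x => f' x - m := hf'.sub (.const m)
  have hs0 : ∫ x, f' x - m ∂μ = 0 := by
    rw [integral_sub hf'.integrable (integrable_const m)]; simp [m]
  have h2 : CesNull x₂ := cesNull_corr_of_ergodic_prod (f := fun x => f' x - m) he hs hf hs0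
  have key : ∀ j : ℤ, ‖∫ x, f (act (j • e) x) * f' x ∂μ‖ ≤ x₁ j.natAbs + x₂ j.natAbs := fun j => by
    obtain ⟨n, rfl | rfl⟩ := Int.eq_nat_or_neg j
    · refine le_trans (le_of_eq ?_) (le_add_of_nonneg_right (norm_nonneg _))
      simp only [natCast_zsmul, hit, Int.natAbs_natCast, x₁]
    · refine le_trans (le_of_eq ?_) (le_add_of_nonneg_left (norm_nonneg _))
      simp only [neg_smul, natCast_zsmul, Int.natAbs_neg, Int.natAbs_natCast, x₂]
      have hfn : BddMeas fun x => f' (act (n • e) x) * f x := (ha.bddMeas_comp _ hf').mul hf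
      have e1 : ∀ x, (f' ((act e)^[n] x) - m) * f x = f' (act (n • e) x) * f x - m * f x :=
        fun x => by rw [hit]; ring
      simp_rw [e1]
      rw [integral_sub hfn.integrable ((BddMeas.const m).mul hf).integrable, integral_const_mul,
        h0, mul_zero, sub_zero, ← ha.integral_comp (-(n • e)) hfn]
      congr 2
      funext x
      rw [← ha.add, add_neg_cancel, ha.zero, mul_comm]
  have hx0 : ∀ n, 0 ≤ x₁ n + x₂ n := fun n => add_nonneg (norm_nonneg _) (norm_nonneg _)
  exact ((h1.add h2).comp hx0 (evenlySpread_natAbs_floor hc)).mono fun h => key _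

end WeakMixing

/-! ### The action of ℤ^ℓ generated by the commuting maps -/

section CommutingMaps

variable {X : Type*} [MeasurableSpace X] {μ : Measure X} {ℓ : ℕ}

/-- The permutations that preserve `μ`, together with their inverses. -/
def preservingPerms (μ : Measure X) : Subgroup (Equiv.Perm X) where
  carrier := {σ | MeasurePreserving σ μ μ ∧ MeasurePreserving σ.symm μ μ}
  mul_mem' := fun ha hb => ⟨ha.1.comp hb.1, hb.2.comp ha.2⟩
  one_mem' := ⟨.id μ, .id μ⟩
  inv_mem' := fun ha => ⟨ha.2, ha.1⟩

lemma exists_preservingAction (T : Fin ℓ → X ≃ᵐ X)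
    (hcomm : ∀ (i j : Fin ℓ) (x : X), T i (T j x) = T j (T i x))
    (hT : ∀ i, MeasurePreserving (T i) μ μ) :
    ∃ act : (Fin ℓ → ℤ) → X → X, PreservingAction μ act ∧
      ∀ i (j : ℤ) x, act (Pi.single i j) x = ((T i).toEquiv ^ j : Equiv.Perm X) x := by
  let t : Fin ℓ → preservingPerms μ := fun i => ⟨(T i).toEquiv, hT i, (hT i).symm (T i)⟩
  have ht : ∀ i j, Commute (t i) (t j) := fun i j =>
    Subtype.ext (Equiv.ext fun x => hcomm i j x)
  have hc : Pairwise fun i j => ∀ x y : Multiplicative ℤ,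
      Commute (zpowersHom _ (t i) x) (zpowersHom _ (t j) y) := fun i j _ x y =>
    (ht i j).zpow_zpow _ _
  let Θ : (Fin ℓ → Multiplicative ℤ) →* preservingPerms μ :=
    MonoidHom.noncommPiCoprod (fun i => zpowersHom _ (t i)) hc
  refine ⟨fun z => (Θ fun i => Multiplicative.ofAdd (z i)).1, ⟨fun x => ?_, fun a b x => ?_,
    fun a => (Θ _).2.1⟩, fun i j x => ?_⟩
  · have : (fun i : Fin ℓ => Multiplicative.ofAdd ((0 : Fin ℓ → ℤ) i)) = 1 := rfl
    rw [this, map_one]; rfl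
  · have : (fun i : Fin ℓ => Multiplicative.ofAdd ((a + b) i)) =
      (fun i => Multiplicative.ofAdd (a i)) * fun i => Multiplicative.ofAdd (b i) := rfl
    rw [this, map_mul]; rfl
  · have : (fun i' : Fin ℓ => Multiplicative.ofAdd ((Pi.single i j : Fin ℓ → ℤ) i')) =
        Pi.mulSingle i (Multiplicative.ofAdd j) := by
      funext i'
      rcases eq_or_ne i' i with rfl | h
      · simp
      · simp [h]
    have h2 := MonoidHom.noncommPiCoprod_mulSingle (ϕ := fun i => zpowersHom _ (t i))
      (hcomm := hc) i (Multiplicative.ofAdd j)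
    simp only [this]
    refine (congrArg (fun σ : preservingPerms μ => σ.1 x) h2).trans ?_
    simp [zpowersHom_apply, t]

end CommutingMaps

/-! ### Polynomial exhaustion on coefficient sequences -/

section PET

variable {ℓ : ℕ}

/-- The coefficients of the shift by `h`: multiplication by `exp (h ∂)` when `v j` is the
coefficient of `∂ ^ j`. -/
noncomputable def shiftCoeff (h : ℝ) (v : ℕ → Fin ℓ → ℝ) : ℕ → Fin ℓ → ℝ := fun j i =>
  ∑ m ∈ Finset.range (j + 1), h ^ m / m.factorial * v (j - m) i

lemma shiftCoeff_sub (h : ℝ) (v w : ℕ → Fin ℓ → ℝ) :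
    shiftCoeff h (v - w) = shiftCoeff h v - shiftCoeff h w := by
  funext j i
  simp [shiftCoeff, mul_sub]

lemma shiftCoeff_apply_of_zero {h : ℝ} {v : ℕ → Fin ℓ → ℝ} {j : ℕ} (hv : ∀ a < j, v a = 0) :
    shiftCoeff h v j = v j := by
  funext i
  rw [shiftCoeff, Finset.sum_range_succ', Finset.sum_eq_zero]
  · simp
  · intro m hm
    rw [Finset.mem_range] at hm
    rw [hv _ (by omega)]
    simp

lemma shiftCoeff_apply_succ_of_zero {h : ℝ} {v : ℕ → Fin ℓ → ℝ} {j : ℕ}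
    (hv : ∀ a < j, v a = 0) : shiftCoeff h v (j + 1) = v (j + 1) + h • v j := by
  funext i
  rw [shiftCoeff, Finset.sum_range_succ', Finset.sum_range_succ', Finset.sum_eq_zero]
  · simp [add_comm]
  · intro m hm
    rw [Finset.mem_range] at hm
    rw [hv _ (by omega)]
    simp

/-- The first nonzero coefficient of `v` has index below `d` and is nonzero in direction `i₀`. -/
def LeadIn (d : ℕ) (i₀ : Fin ℓ) (v : ℕ → Fin ℓ → ℝ) : Prop :=
  ∃ e < d, (∀ j < e, v j = 0) ∧ v e i₀ ≠ 0

/-- The first nonzero coefficient of `v` has index `e`. -/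
def HasOrd (v : ℕ → Fin ℓ → ℝ) (e : ℕ) : Prop := (∀ j < e, v j = 0) ∧ v e ≠ 0

lemma HasOrd.unique {v : ℕ → Fin ℓ → ℝ} {a b : ℕ} (ha : HasOrd v a) (hb : HasOrd v b) : a = b := by
  rcases lt_trichotomy a b with h | h | h
  · exact absurd (hb.1 a h) ha.2
  · exact h
  · exact absurd (ha.1 b h) hb.2

lemma exists_hasOrd {d : ℕ} {v : ℕ → Fin ℓ → ℝ} (hv : ¬ ∀ j < d, v j = 0) :
    ∃ e < d, HasOrd v e := by
  classical
  push Not at hv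
  obtain ⟨hlt, hne⟩ := Nat.find_spec hv
  exact ⟨Nat.find hv, hlt, fun j hj => by
    by_contra h
    exact Nat.find_min hv hj ⟨hj.trans hlt, h⟩, hne⟩

lemma LeadIn.shift {d : ℕ} {i₀ : Fin ℓ} {v : ℕ → Fin ℓ → ℝ} (hv : LeadIn d i₀ v) (h : ℝ) :
    LeadIn d i₀ (shiftCoeff h v) := by
  obtain ⟨e, he, hz, hne⟩ := hv
  refine ⟨e, he, fun j hj => ?_, ?_⟩
  · rw [shiftCoeff_apply_of_zero fun a ha => hz a (ha.trans hj), hz j hj]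
  · rwa [shiftCoeff_apply_of_zero hz]

lemma LeadIn.apply_ne_zero {d e : ℕ} {i₀ : Fin ℓ} {v : ℕ → Fin ℓ → ℝ} (hv : LeadIn d i₀ v)
    (hz : ∀ j < e, v j = 0) (hne : v e ≠ 0) : v e i₀ ≠ 0 := by
  obtain ⟨e', -, hz', hne'⟩ := hv
  have : e' = e := HasOrd.unique (v := v) ⟨hz', fun h => hne' (by rw [h]; rfl)⟩ ⟨hz, hne⟩
  exact this ▸ hne'

open Classical in
/-- The number of leading coefficients of index `e` that occur in a family. -/
noncomputable def classCount {ι : Type} [Fintype ι] (r : ι → ℕ → Fin ℓ → ℝ) (e : ℕ) : ℕ :=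
  ((Finset.univ.filter fun q => HasOrd (r q) e).image fun q => r q e).card

lemma toLex_lt_of_le {d : ℕ} {a b : Fin d → ℕ} {e : Fin d} (h : ∀ j < e, a j ≤ b j)
    (he : a e < b e) : toLex a < toLex b := by
  by_contra hn
  rcases (not_lt.1 hn).eq_or_lt with heq | ⟨i, hi, hlt⟩
  · have : b = a := toLex.injective heq
    rw [this] at he
    exact lt_irrefl _ he
  · rcases lt_trichotomy i e with hie | rfl | hie
    · exact absurd hlt (not_lt.2 (h i hie))
    · exact absurd hlt (not_lt.2 he.le)
    · exact absurd (hi e hie) he.ne'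

/-- The family obtained from `r` by the van der Corput operation with shift `h`, translated by the
member with index `s`. -/
noncomputable def vdCFamily {ι : Type} (r : ι → ℕ → Fin ℓ → ℝ) (s : ι) (h : ℝ) (q : ι × Bool) :
    ℕ → Fin ℓ → ℝ :=
  (if q.2 then shiftCoeff h (r q.1) else r q.1) - r s

lemma vdCFamily_apply_of_zero {ι : Type} {r : ι → ℕ → Fin ℓ → ℝ} {s : ι} {h : ℝ} {q : ι × Bool}
    {j : ℕ} (hq : ∀ a < j, r q.1 a = 0) : vdCFamily r s h q j = r q.1 j - r s j := by
  rcases q with ⟨q, _ | _⟩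
  · rfl
  · simp only [vdCFamily, if_true, Pi.sub_apply]
    rw [shiftCoeff_apply_of_zero hq]

lemma eq_zero_of_vdCFamily {ι : Type} {r : ι → ℕ → Fin ℓ → ℝ} {s : ι} {h : ℝ} {q : ι × Bool}
    {e : ℕ} (hs : ∀ j < e, r s j = 0) (hw : ∀ j < e, vdCFamily r s h q j = 0) :
    ∀ j < e, r q.1 j = 0 := by
  intro j
  induction j using Nat.strong_induction_on with
  | _ j ih =>
    intro hj
    have := hw j hj
    rwa [vdCFamily_apply_of_zero fun a ha => ih a ha (ha.trans hj), hs j hj, sub_zero] at this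

/-- Below e the member s vanishes, so no new leading coefficients appear there. At e they all get
translated by −r s e, and the value r s e itself becomes zero and drops out; since no member has
order above e, nothing new enters at e. Counts above e may grow, but the lexicographic order ranks
them lower. -/
lemma classCount_vdCFamily_lt {ι : Type} [Fintype ι] {r : ι → ℕ → Fin ℓ → ℝ} {s : ι} {h : ℝ}
    {d e : ℕ} (hed : e < d) (hs : HasOrd (r s) e) (hmax : ∀ q, ∃ e' ≤ e, HasOrd (r q) e')
    (P : ι × Bool → Prop) [DecidablePred P] :
    toLex (fun j : Fin d => classCount (fun q : {q // P q} => vdCFamily r s h q) j) <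
      toLex (fun j : Fin d => classCount r j) := by
  classical
  refine toLex_lt_of_le (e := ⟨e, hed⟩) (fun j hj => ?_) ?_
  · refine Finset.card_le_card fun y hy => ?_
    simp only [Finset.mem_image, Finset.mem_filter, Finset.mem_univ, true_and] at hy ⊢
    obtain ⟨q, hq, rfl⟩ := hy
    have hj' : (j : ℕ) < e := hj
    have hz := eq_zero_of_vdCFamily (fun a ha => hs.1 a (ha.trans hj')) hq.1
    have hval := vdCFamily_apply_of_zero (s := s) (h := h) hz
    rw [hs.1 j hj', sub_zero] at hval
    exact ⟨q.1.1, ⟨hz, hval ▸ hq.2⟩, hval.symm⟩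
  · have hmem : r s e ∈ (Finset.univ.filter fun q => HasOrd (r q) e).image fun q => r q e :=
      Finset.mem_image.2 ⟨s, by simpa using hs, rfl⟩
    refine lt_of_le_of_lt ?_ (Finset.card_erase_lt_of_mem hmem)
    refine (Finset.card_le_card fun y hy => ?_).trans
      (Finset.card_image_le (f := fun y => y - r s e))
    simp only [Finset.mem_image, Finset.mem_filter, Finset.mem_univ, true_and,
      Finset.mem_erase] at hy ⊢
    obtain ⟨q, hq, rfl⟩ := hy
    have hz := eq_zero_of_vdCFamily hs.1 hq.1
    have hval := vdCFamily_apply_of_zero (s := s) (h := h) hz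
    have hord : HasOrd (r q.1.1) e := by
      obtain ⟨e', he', ho⟩ := hmax q.1.1
      rcases he'.eq_or_lt with rfl | hlt
      · exact ho
      · exact absurd (hz e' hlt) ho.2
    refine ⟨r q.1.1 e, ⟨fun h => hq.2 ?_, q.1.1, hord, rfl⟩, hval.symm⟩
    rw [hval, h, sub_self]

/-- The induction scheme of polynomial exhaustion, for families of coefficient sequences. -/
theorem pet_induction {d : ℕ} {i₀ : Fin ℓ}
    (Q : ∀ (ι : Type) [Fintype ι], (ι → ℕ → Fin ℓ → ℝ) → ι → Prop)
    (hbase : ∀ (ι : Type) [Fintype ι] (r : ι → ℕ → Fin ℓ → ℝ) (k : ι),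
      (∀ q j, j + 1 < d → r q j = 0) → r k (d - 1) i₀ ≠ 0 →
      (∀ q, q ≠ k → r q (d - 1) i₀ ≠ r k (d - 1) i₀) → Q ι r k)
    (hstep : ∀ (ι : Type) [Fintype ι] (r : ι → ℕ → Fin ℓ → ℝ) (k s : ι)
      (Z : ℕ → ι × Bool → Prop) [∀ h, DecidablePred (Z h)],
      (∀ h q, Z h q → ∀ j < d, vdCFamily r s h q j = 0) →
      (∀ᶠ h : ℕ in atTop, ∃ hk : ¬ Z h (k, true),
        Q {q // ¬ Z h q} (fun q => vdCFamily r s h q) ⟨(k, true), hk⟩) → Q ι r k)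
    {ι : Type} [Fintype ι] (r : ι → ℕ → Fin ℓ → ℝ) (k : ι) (h0 : ∀ q, ¬ ∀ j < d, r q j = 0)
    (hlead : ∀ q, q ≠ k → LeadIn d i₀ (r k - r q)) {e₀ : ℕ} (he₀ : e₀ < d)
    (htop : ∀ q, ∀ j < e₀, r q j = 0) (hk : r k e₀ i₀ ≠ 0) : Q ι r k := by
  classical
  obtain ⟨W, hW⟩ : ∃ W : Lex (Fin d → ℕ), W = toLex (fun j : Fin d => classCount r j) := ⟨_, rfl⟩
  induction W using WellFoundedLT.induction generalizing ι e₀ with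
  | _ W ih =>
  subst hW
  rcases Nat.lt_or_ge (e₀ + 1) d with hd | hd
  swap
  · obtain rfl : d = e₀ + 1 := by omega
    refine hbase ι r k (fun q j hj => htop q j (by omega)) hk fun q hq heq => ?_
    obtain ⟨e, he, hz, hne⟩ := hlead q hq
    rcases Nat.lt_or_ge e e₀ with h | h
    · simp [htop q e h, htop k e h] at hne
    · obtain rfl : e = e₀ := by omega
      exact hne (by simpa [sub_eq_zero] using heq.symm)
  have hdiff : ∀ q, r q e₀ ≠ r k e₀ → r k e₀ i₀ - r q e₀ i₀ ≠ 0 := fun q hq => by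
    have hqk : q ≠ k := fun h => hq (by rw [h])
    exact (hlead q hqk).apply_ne_zero (fun j hj => by simp [htop q j hj, htop k j hj])
      (by simpa [sub_eq_zero] using hq.symm)
  choose o hod ho using fun q => exists_hasOrd (h0 q)
  have hoe : ∀ q, e₀ ≤ o q := fun q => by
    by_contra hlt
    exact (ho q).2 (htop q _ (not_le.1 hlt))
  have hoeq : ∀ q, r q e₀ ≠ 0 → o q = e₀ := fun q hq => (ho q).unique ⟨htop q, hq⟩
  have hk0 : r k e₀ ≠ 0 := fun h => hk (by rw [h]; rfl)
  -- The translating member has lowest degree, that is largest order, among those differing from k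
  -- at e₀. Members agreeing with k there have the least order e₀, so s is extremal in the whole
  -- family. If all agree, s = k and the common top index moves to e₀ + 1.
  obtain ⟨s, hmax, hs⟩ : ∃ s, (∀ q, o q ≤ o s) ∧
      (r s e₀ ≠ r k e₀ ∨ s = k ∧ ∀ q, r q e₀ = r k e₀) := by
    by_cases hall : ∀ q, r q e₀ = r k e₀
    · exact ⟨k, fun q => by rw [hoeq q (by rw [hall]; exact hk0), hoeq k hk0], .inr ⟨rfl, hall⟩⟩
    · push Not at hall
      obtain ⟨q₀, hq₀⟩ := hall
      obtain ⟨s, hs, hsmax⟩ := Finset.exists_max_image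
        (Finset.univ.filter fun q => r q e₀ ≠ r k e₀) o ⟨q₀, by simpa using hq₀⟩
      simp only [Finset.mem_filter, Finset.mem_univ, true_and] at hs hsmax
      refine ⟨s, fun q => ?_, .inl hs⟩
      by_cases hq : r q e₀ = r k e₀
      · rw [hoeq q (by rw [hq]; exact hk0)]
        exact hoe s
      · exact hsmax q hq
  refine hstep ι r k s (fun h q => ∀ j < d, vdCFamily r s h q j = 0)
    (fun h q hq => hq) ?_
  -- A shifted k and an unshifted q (possibly k itself) with equal coefficients at e₀ first differ
  -- at e₀ + 1, through the term h • r k e₀; all but finitely many h avoid cancellation in direction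
  -- i₀.
  have hgen : ∀ᶠ h : ℕ in atTop, ∀ q,
      r k (e₀ + 1) i₀ + h * r k e₀ i₀ - r q (e₀ + 1) i₀ ≠ 0 := by
    rw [eventually_all]
    intro q
    have : Function.Injective fun h : ℕ =>
        r k (e₀ + 1) i₀ + h * r k e₀ i₀ - r q (e₀ + 1) i₀ := fun a b hab => by
      have : ((a : ℝ) - b) * r k e₀ i₀ = 0 := by simp only at hab; linarith
      rcases mul_eq_zero.1 this with h | h
      · exact_mod_cast sub_eq_zero.1 h
      · exact absurd h hk
    exact Nat.cofinite_eq_atTop ▸ this.tendsto_cofinite.eventually (eventually_cofinite_ne 0)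
  filter_upwards [hgen, eventually_ge_atTop 1] with h hh h1
  have hh0 : (h : ℝ) ≠ 0 := by exact_mod_cast (by omega : h ≠ 0)
  have hzero : ∀ q, ∀ j < e₀, vdCFamily r s h q j = 0 := fun q j hj => by
    rw [vdCFamily_apply_of_zero fun a ha => htop q.1 a (ha.trans hj), htop _ j hj, htop s j hj,
      sub_zero]
  obtain ⟨e₁, he₁, htop₁, hk₁⟩ : ∃ e₁ < d, (∀ q, ∀ j < e₁, vdCFamily r s h q j = 0) ∧
      vdCFamily r s h (k, true) e₁ i₀ ≠ 0 := by
    rcases hs with hs | ⟨rfl, hall⟩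
    · refine ⟨e₀, he₀, hzero, ?_⟩
      rw [vdCFamily_apply_of_zero (htop k)]
      exact hdiff s hs
    · refine ⟨e₀ + 1, hd, fun q j hj => ?_, ?_⟩
      · rcases (Nat.lt_succ_iff.1 hj).eq_or_lt with rfl | hj
        · rw [vdCFamily_apply_of_zero (htop q.1), hall, sub_self]
        · exact hzero q j hj
      · simp only [vdCFamily, if_true, Pi.sub_apply]
        rw [shiftCoeff_apply_succ_of_zero (htop s)]
        simpa using ⟨by omega, hk⟩
  have hkP : ¬ ∀ j < d, vdCFamily r s h (k, true) j = 0 := fun hz => hk₁ (by rw [hz e₁ he₁]; rfl)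
  refine ⟨hkP, ih _ (classCount_vdCFamily_lt (hod s) (ho s) (fun q => ⟨o q, hmax q, ho q⟩) _)
    (fun q : {q // ¬ ∀ j < d, vdCFamily r s h q j = 0} => vdCFamily r s h q) ⟨(k, true), hkP⟩
    (fun q => q.2) (fun q hq => ?_) he₁ (fun q => htop₁ q.1) hk₁ rfl⟩
  have hq' : q.1 ≠ (k, true) := fun h => hq (Subtype.ext h)
  obtain ⟨⟨q, b⟩, hqP⟩ := q
  rcases b with _ | _
  · have hval : vdCFamily r s h (k, true) - vdCFamily r s h (q, false) =
        shiftCoeff h (r k) - r q := by simp [vdCFamily]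
    simp only
    rw [hval]
    by_cases hqk : r q e₀ = r k e₀
    · refine ⟨e₀ + 1, hd, fun j hj => ?_, ?_⟩
      · rcases (Nat.lt_succ_iff.1 hj).eq_or_lt with rfl | hj
        · rw [Pi.sub_apply, shiftCoeff_apply_of_zero (htop k), hqk, sub_self]
        · rw [Pi.sub_apply, shiftCoeff_apply_of_zero fun a ha => htop k a (ha.trans hj),
            htop k j hj, htop q j hj, sub_self]
      · rw [Pi.sub_apply, shiftCoeff_apply_succ_of_zero (htop k)]
        simpa using hh q
    · refine ⟨e₀, he₀, fun j hj => ?_, ?_⟩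
      · rw [Pi.sub_apply, shiftCoeff_apply_of_zero fun a ha => htop k a (ha.trans hj),
          htop k j hj, htop q j hj, sub_self]
      · rw [Pi.sub_apply, shiftCoeff_apply_of_zero (htop k)]
        exact hdiff q hqk
  · have hqk : q ≠ k := fun h => hq' (by simp [h])
    have hval : vdCFamily r s h (k, true) - vdCFamily r s h (q, true) =
        shiftCoeff h (r k - r q) := by simp [vdCFamily, shiftCoeff_sub]
    simp only
    rw [hval]
    exact (hlead q hqk).shift h

end PET

/-! ### Combinations of derivatives, Taylor shifts and time changes -/

section Evaluation

variable {ℓ : ℕ}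

/-- The combination of the derivatives `D i j`, `j < d`, with coefficients `v j i`. -/
noncomputable def combo (D : Fin ℓ → ℕ → ℝ → ℝ) (d : ℕ) (v : ℕ → Fin ℓ → ℝ) (i : Fin ℓ) (x : ℝ) :
    ℝ := ∑ j ∈ Finset.range d, v j i * D i j x

/-- The integer parts of `combo` along the natural numbers. -/
noncomputable def evalSeq (D : Fin ℓ → ℕ → ℝ → ℝ) (d : ℕ) (v : ℕ → Fin ℓ → ℝ) (n : ℕ) :
    Fin ℓ → ℤ := fun i => ⌊combo D d v i n⌋

lemma combo_sub (D : Fin ℓ → ℕ → ℝ → ℝ) (d : ℕ) (v w : ℕ → Fin ℓ → ℝ) (i : Fin ℓ) (x : ℝ) :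
    combo D d (v - w) i x = combo D d v i x - combo D d w i x := by
  simp [combo, sub_mul]

lemma combo_eq_zero {D : Fin ℓ → ℕ → ℝ → ℝ} {d : ℕ} {v : ℕ → Fin ℓ → ℝ}
    (hv : ∀ j < d, v j = 0) (i : Fin ℓ) (x : ℝ) : combo D d v i x = 0 :=
  Finset.sum_eq_zero fun j hj => by rw [hv j (Finset.mem_range.1 hj)]; simp

lemma combo_shiftCoeff (D : Fin ℓ → ℕ → ℝ → ℝ) (d : ℕ) (v : ℕ → Fin ℓ → ℝ) (h : ℝ) (i : Fin ℓ)
    (x : ℝ) : combo D d (shiftCoeff h v) i x =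
      ∑ a ∈ Finset.range d, v a i *
        ∑ m ∈ Finset.range (d - a), h ^ m / m.factorial * D i (a + m) x := by
  simp_rw [Finset.mul_sum]
  rw [← Finset.sum_range_diag_flip d fun a m => v a i * (h ^ m / m.factorial * D i (a + m) x)]
  refine Finset.sum_congr rfl fun j _ => ?_
  rw [shiftCoeff, Finset.sum_mul,
    ← Finset.sum_flip fun a => v a i * (h ^ (j - a) / (j - a).factorial * D i (a + (j - a)) x)]
  refine Finset.sum_congr rfl fun m hm => ?_
  have hmj : m ≤ j := Nat.lt_succ_iff.1 (Finset.mem_range.1 hm)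
  rw [Nat.sub_sub_self hmj, Nat.sub_add_cancel hmj]
  ring

lemma hasDerivAt_taylor_sum (c : ℕ → ℝ) (J : ℕ) (t : ℝ) :
    HasDerivAt (fun t : ℝ => ∑ m ∈ Finset.range (J + 1), t ^ m / m.factorial * c m)
      (∑ m ∈ Finset.range J, t ^ m / m.factorial * c (m + 1)) t := by
  simp_rw [Finset.sum_range_succ' _ J]
  simp only [pow_zero, Nat.factorial_zero, Nat.cast_one, div_one, one_mul]
  refine HasDerivAt.add_const _ ?_
  refine HasDerivAt.fun_sum fun m _ => ?_
  have h := ((hasDerivAt_pow (m + 1) t).div_const ((m + 1).factorial : ℝ)).mul_const (c (m + 1))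
  refine h.congr_deriv ?_
  rw [Nat.factorial_succ]
  push_cast
  have : ((m : ℝ) + 1) ≠ 0 := by positivity
  have h2 : (m.factorial : ℝ) ≠ 0 := by positivity
  field_simp

/-- If the `d`-th derivative is bounded, shifts agree with Taylor sums up to a bounded error. -/
lemma exists_taylor_bound {G : ℕ → ℝ → ℝ} {x₀ : ℝ}
    (hG : ∀ j, ∀ x > x₀, HasDerivAt (G j) (G (j + 1) x) x) {d : ℕ} (hd : ∀ x > x₀, |G d x| ≤ 1)
    (H : ℝ) (J a : ℕ) (hJ : a + J = d) : ∃ B, 0 ≤ B ∧ ∀ x > x₀, ∀ t ∈ Set.Icc 0 H,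
      |G a (x + t) - ∑ m ∈ Finset.range J, t ^ m / m.factorial * G (a + m) x| ≤ B := by
  induction J generalizing a with
  | zero =>
    obtain rfl : a = d := by omega
    refine ⟨1, zero_le_one, fun x hx t ht => ?_⟩
    simpa using hd (x + t) (by linarith [ht.1])
  | succ J ih =>
    obtain ⟨B, hB0, hB⟩ := ih (a + 1) (by omega)
    refine ⟨B * |H|, by positivity, fun x hx t ht => ?_⟩
    -- The t-derivative of the error at order a is the error at order a + 1, so the mean value
    -- inequality costs a factor |H|.
    set E : ℝ → ℝ := fun t =>
      G a (x + t) - ∑ m ∈ Finset.range (J + 1), t ^ m / m.factorial * G (a + m) x with hE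
    have hE0 : E 0 = 0 := by
      simp only [hE]
      rw [Finset.sum_range_succ', Finset.sum_eq_zero]
      · simp
      · intro m _
        rw [zero_pow (Nat.succ_ne_zero m), zero_div, zero_mul]
    have hder : ∀ y ∈ Set.Icc 0 H, HasDerivWithinAt E (G (a + 1) (x + y) -
        ∑ m ∈ Finset.range J, y ^ m / m.factorial * G (a + 1 + m) x) (Set.Icc 0 H) y := by
      intro y hy
      have h1 : HasDerivAt (fun t => G a (x + t)) (G (a + 1) (x + y)) y := by
        have := HasDerivAt.comp_const_add x y (hG a (x + y) (by linarith [hy.1]))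
        exact this
      have h2 := (hasDerivAt_taylor_sum (fun m => G (a + m) x) J y).congr_deriv
        (Finset.sum_congr rfl fun m _ => by rw [show a + (m + 1) = a + 1 + m by ring])
      exact (h1.sub h2).hasDerivWithinAt
    have := Convex.norm_image_sub_le_of_norm_hasDerivWithin_le (f := E) hder
      (C := B) (fun y hy => hB x hx y hy) (convex_Icc 0 H)
      (Set.left_mem_Icc.2 (ht.1.trans ht.2)) ht
    rw [hE0, sub_zero, sub_zero, Real.norm_eq_abs, Real.norm_eq_abs, abs_of_nonneg ht.1] at this
    refine this.trans ?_
    have : t ≤ |H| := ht.2.trans (le_abs_self H)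
    gcongr

lemma exists_combo_shift_bound {D : Fin ℓ → ℕ → ℝ → ℝ} {x₀ : ℝ}
    (hD : ∀ i j, ∀ x > x₀, HasDerivAt (D i j) (D i (j + 1) x) x) {d : ℕ}
    (hd : ∀ i, ∀ x > x₀, |D i d x| ≤ 1) (v : ℕ → Fin ℓ → ℝ) (h : ℕ) :
    ∃ C, ∀ᶠ n : ℕ in atTop, ∀ i,
      |combo D d v i (n + h : ℕ) - combo D d (shiftCoeff h v) i n| ≤ C := by
  have h1 : ∀ (i : Fin ℓ) (a : ℕ), ∃ B, 0 ≤ B ∧ (a < d → ∀ x > x₀,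
      |D i a (x + h) - ∑ m ∈ Finset.range (d - a), (h : ℝ) ^ m / m.factorial * D i (a + m) x|
        ≤ B) := fun i a => by
    by_cases ha : a < d
    · obtain ⟨B, hB0, hB⟩ := exists_taylor_bound (hD i) (hd i) h (d - a) a (by omega)
      exact ⟨B, hB0, fun _ x hx => hB x hx h ⟨by positivity, le_rfl⟩⟩
    · exact ⟨0, le_rfl, fun h => absurd h ha⟩
  choose B hB0 hB using h1
  refine ⟨∑ i, ∑ a ∈ Finset.range d, |v a i| * B i a, ?_⟩
  filter_upwards [tendsto_natCast_atTop_atTop.eventually_gt_atTop x₀] with n hn i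
  refine le_trans ?_ (Finset.single_le_sum
    (f := fun i => ∑ a ∈ Finset.range d, |v a i| * B i a)
    (fun i _ => Finset.sum_nonneg fun a _ => mul_nonneg (abs_nonneg _) (hB0 _ _))
    (Finset.mem_univ i))
  rw [combo_shiftCoeff, combo, ← Finset.sum_sub_distrib]
  refine (Finset.abs_sum_le_sum_abs _ _).trans (Finset.sum_le_sum fun a ha => ?_)
  rw [← mul_sub, abs_mul]
  refine mul_le_mul_of_nonneg_left ?_ (abs_nonneg _)
  push_cast
  exact hB i a (Finset.mem_range.1 ha) n hn

/-- Integer vectors with entries bounded by `C`. -/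
def box (ℓ : ℕ) (C : ℝ) : Set (Fin ℓ → ℤ) := {z | ∀ i, |(z i : ℝ)| ≤ C}

lemma finite_box (C : ℝ) : (box ℓ C).Finite := by
  refine (Set.finite_Icc (fun _ : Fin ℓ => -⌈C⌉) fun _ => ⌈C⌉).subset fun z hz => ⟨fun i => ?_,
    fun i => ?_⟩
  · have := (abs_le.1 (hz i)).1
    have h : ((-⌈C⌉ : ℤ) : ℝ) ≤ z i := by push_cast; linarith [Int.le_ceil C]
    exact_mod_cast h
  · have := (abs_le.1 (hz i)).2
    have h : (z i : ℝ) ≤ ⌈C⌉ := by linarith [Int.le_ceil C]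
    exact_mod_cast h

lemma abs_floor_sub_floor_sub_floor_le {a b c C : ℝ} (h : |a - b - c| ≤ C) :
    |((⌊a⌋ - ⌊b⌋ - ⌊c⌋ : ℤ) : ℝ)| ≤ C + 2 := by
  push_cast
  have h1 := Int.floor_le a
  have h2 := Int.lt_floor_add_one a
  have h3 := Int.floor_le b
  have h4 := Int.lt_floor_add_one b
  have h5 := Int.floor_le c
  have h6 := Int.lt_floor_add_one c
  rw [abs_le] at h ⊢
  constructor <;> linarith [h.1, h.2]

lemma abs_floor_sub_floor_le {a b C : ℝ} (h : |a - b| ≤ C) :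
    |((⌊a⌋ - ⌊b⌋ : ℤ) : ℝ)| ≤ C + 2 := by
  have := abs_floor_sub_floor_sub_floor_le (c := 0) (by rwa [sub_zero] : |a - b - 0| ≤ C)
  simpa using this

/-- There is a time change after which `φ i₀` is linear and the other `φ i` are slowly varying. -/
def HasTimeChange (φ : Fin ℓ → ℝ → ℝ) (i₀ : Fin ℓ) : Prop :=
  ∃ (t : ℕ → ℝ) (τ : ℕ → ℕ) (σ : ℝ), σ ≠ 0 ∧ EvenlySpread τ ∧
    (∀ᶠ n : ℕ in atTop, ∀ i, |φ i n - φ i (t (τ n))| ≤ 1) ∧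
    (∀ h, ∀ᶠ m in atTop, ∀ i, i ≠ i₀ → |φ i (t (m + h)) - φ i (t m)| ≤ 1) ∧
    ∀ h : ℕ, ∀ᶠ m in atTop, φ i₀ (t (m + h)) - φ i₀ (t m) = σ * h

variable {X : Type*} [MeasurableSpace X] {μ : Measure X} [IsProbabilityMeasure μ]
  {act : (Fin ℓ → ℤ) → X → X}

/-- In the new time the sequences have slopes σ · c q i₀ along i₀ and bounded increments elsewhere,
as `normGood_of_almost_linear` requires. -/
lemma normGood_of_hasTimeChange (ha : PreservingAction μ act) {i₀ : Fin ℓ}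
    (he : MixingAlong μ act (Pi.single i₀ 1)) {φ : Fin ℓ → ℝ → ℝ} (hφ : HasTimeChange φ i₀)
    {ι : Type} [Fintype ι] (c : ι → Fin ℓ → ℝ) (k : ι) (hk : c k i₀ ≠ 0)
    (hq : ∀ q, q ≠ k → c q i₀ ≠ c k i₀) :
    NormGood μ act (fun q (n : ℕ) i => ⌊c q i * φ i n⌋) k := by
  obtain ⟨t, τ, σ, hσ, hτ, h1, h2, h3⟩ := hφ
  obtain ⟨C, hC⟩ : ∃ C, ∀ q i, |c q i| ≤ C := by
    obtain ⟨C, hC⟩ := (Set.finite_range fun p : ι × Fin ℓ => |c p.1 p.2|).bddAbove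
    exact ⟨C, fun q i => hC ⟨(q, i), rfl⟩⟩
  have hC0 : 0 ≤ C := (abs_nonneg _).trans (hC k i₀)
  refine NormGood.of_comp ha (b := fun q m i => ⌊c q i * φ i (t m)⌋) ?_ hτ
    (finite_box (C + 2)) ?_
  · refine normGood_of_almost_linear ha he _ k (fun q => σ * c q i₀) (mul_ne_zero hσ hk)
      (fun q hqk h => hq q hqk (mul_left_cancel₀ hσ h)) (finite_box (C + 2)) fun h => ?_
    filter_upwards [h2 h, h3 h] with m hm2 hm3 q i
    rcases eq_or_ne i i₀ with rfl | hi
    · simp only [Pi.sub_apply, Pi.smul_apply, Pi.single_eq_same, smul_eq_mul, mul_one]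
      refine abs_floor_sub_floor_sub_floor_le ?_
      rw [← mul_sub, hm3]
      rw [show c q i * (σ * h) - σ * c q i * h = 0 by ring, abs_zero]
      exact hC0
    · simp only [Pi.sub_apply, Pi.smul_apply, Pi.single_eq_of_ne hi, smul_zero, sub_zero]
      refine abs_floor_sub_floor_le ?_
      rw [← mul_sub, abs_mul]
      calc _ ≤ C * 1 := mul_le_mul (hC q i) (hm2 i hi) (abs_nonneg _) hC0
        _ = C := mul_one C
  · filter_upwards [h1] with n hn q i
    refine abs_floor_sub_floor_le ?_
    rw [← mul_sub, abs_mul]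
    calc _ ≤ C * 1 := mul_le_mul (hC q i) (hn i) (abs_nonneg _) hC0
      _ = C := mul_one C

/-- One exhaustion step read on actual sequences: subtracting s is a translation permitted by
invariance, and members with zero coefficients become stationary and join the test function. Taylor
and floor errors lie in a finite box. -/
lemma normGood_of_vdCFamily (ha : PreservingAction μ act) {D : Fin ℓ → ℕ → ℝ → ℝ} {x₀ : ℝ}
    (hD : ∀ i j, ∀ x > x₀, HasDerivAt (D i j) (D i (j + 1) x) x) {d : ℕ}
    (hd : ∀ i, ∀ x > x₀, |D i d x| ≤ 1) {ι : Type} [Fintype ι] (r : ι → ℕ → Fin ℓ → ℝ) (k s : ι)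
    (Z : ℕ → ι × Bool → Prop) [∀ h, DecidablePred (Z h)]
    (hZ : ∀ h q, Z h q → ∀ j < d, vdCFamily r s h q j = 0)
    (hgood : ∀ᶠ h : ℕ in atTop, ∃ hk : ¬ Z h (k, true),
      NormGood μ act (fun (q : {q // ¬ Z h q}) => evalSeq D d (vdCFamily r s h q))
        ⟨(k, true), hk⟩) :
    NormGood μ act (fun q => evalSeq D d (r q)) k := by
  refine NormGood.of_scalarGood ha ?_
  filter_upwards [hgood] with h ⟨hk, hN⟩
  choose C hC using fun q => exists_combo_shift_bound hD hd (r q) h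
  obtain ⟨B, hB⟩ := (Set.finite_range C).bddAbove
  have hS : ScalarGood μ act
      (fun q n => evalSeq D d (vdCFamily r s h q) n + evalSeq D d (r s) n) (k, true) := by
    refine ScalarGood.of_normGood ha (evalSeq D d (r s)) (Z h) hk (fun q hq n => ?_) ?_
    · funext i
      simp [evalSeq, combo_eq_zero (hZ h q hq)]
    · simpa using hN
  refine hS.perturb ha (finite_box (max B 0 + 2)) ?_
  filter_upwards [eventually_all.2 hC] with n hn q i
  have e : ∀ a b c : ℤ, a - (b + c) = a - b - c := fun a b c => by ring
  rcases q with ⟨q, _ | _⟩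
  · simp only [Pi.sub_apply, Pi.add_apply, evalSeq, e]
    refine abs_floor_sub_floor_sub_floor_le ?_
    simp [vdCFamily, combo_sub]
  · simp only [Pi.sub_apply, Pi.add_apply, evalSeq, e]
    refine abs_floor_sub_floor_sub_floor_le ?_
    simp only [vdCFamily, if_true, combo_sub]
    rw [sub_sub, sub_add_cancel]
    exact (hn q i).trans ((hB ⟨q, rfl⟩).trans (le_max_left _ _))

/-- Multiple averages along combinations of derivatives tend to zero. -/
theorem normGood_evalSeq (ha : PreservingAction μ act) {i₀ : Fin ℓ}
    (he : MixingAlong μ act (Pi.single i₀ 1)) {D : Fin ℓ → ℕ → ℝ → ℝ} {x₀ : ℝ}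
    (hD : ∀ i j, ∀ x > x₀, HasDerivAt (D i j) (D i (j + 1) x) x) {d : ℕ}
    (hd : ∀ i, ∀ x > x₀, |D i d x| ≤ 1) (hφ : HasTimeChange (fun i => D i (d - 1)) i₀)
    {ι : Type} [Fintype ι] (r : ι → ℕ → Fin ℓ → ℝ) (k : ι) (h0 : ∀ q, ¬ ∀ j < d, r q j = 0)
    (hlead : ∀ q, q ≠ k → LeadIn d i₀ (r k - r q)) {e₀ : ℕ} (he₀ : e₀ < d)
    (htop : ∀ q, ∀ j < e₀, r q j = 0) (hk : r k e₀ i₀ ≠ 0) :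
    NormGood μ act (fun q => evalSeq D d (r q)) k := by
  refine pet_induction (d := d) (i₀ := i₀)
    (fun ι _ r k => NormGood μ act (fun q => evalSeq D d (r q)) k) ?_ ?_ r k h0 hlead he₀ htop hk
  · intro ι _ r k hz hk hq
    have hev : (fun q => evalSeq D d (r q)) =
        fun q (n : ℕ) i => ⌊r q (d - 1) i * D i (d - 1) n⌋ := by
      funext q n i
      rw [evalSeq, combo, Finset.sum_eq_single_of_mem (d - 1) (Finset.mem_range.2 (by omega))]
      intro j hj hne
      rw [hz q j (by have := Finset.mem_range.1 hj; omega)]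
      simp
    rw [hev]
    exact normGood_of_hasTimeChange ha he hφ (fun q => r q (d - 1)) k hk hq
  · intro ι _ r k s Z _ hZ hgood
    exact normGood_of_vdCFamily ha hD hd r k s Z hZ hgood

end Evaluation

/-! ### Functions with regular logarithmic derivative -/

section Regularity

lemma monotoneOn_Ici_of_hasDerivAt {f f' : ℝ → ℝ} {a : ℝ}
    (h : ∀ x ≥ a, HasDerivAt f (f' x) x) (h0 : ∀ x ≥ a, 0 ≤ f' x) : MonotoneOn f (Set.Ici a) :=
  monotoneOn_of_hasDerivWithinAt_nonneg (convex_Ici a)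
    (fun x hx => (h x hx).continuousAt.continuousWithinAt)
    (fun x hx => (h x (interior_subset hx)).hasDerivWithinAt) fun x hx => h0 x (interior_subset hx)

lemma eventually_pos_or_neg {f : ℝ → ℝ} {x₀ : ℝ} (hf : ∀ x > x₀, ContinuousAt f x)
    (hne : ∀ᶠ x in atTop, f x ≠ 0) : (∀ᶠ x in atTop, 0 < f x) ∨ ∀ᶠ x in atTop, f x < 0 := by
  obtain ⟨a, ha⟩ := eventually_atTop.1 (hne.and (eventually_gt_atTop x₀))
  have hc : ContinuousOn f (Set.Ici a) := fun x hx => (hf x (ha x hx).2).continuousWithinAt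
  by_contra hcon
  rw [not_or] at hcon
  obtain ⟨h1, h2⟩ := hcon
  simp only [not_eventually, not_lt] at h1 h2
  obtain ⟨x, hx, hxa⟩ := (h1.and_eventually (eventually_ge_atTop a)).exists
  obtain ⟨y, hy, hya⟩ := (h2.and_eventually (eventually_ge_atTop a)).exists
  obtain ⟨z, hz, hz0⟩ := isPreconnected_Ici.intermediate_value hxa hya hc ⟨hx, hy⟩
  exact (ha z hz).1 hz0

/-- The function log |y| − (κ/2) log x is eventually nondecreasing. `Real.log` ignores signs, so
none is imposed on y. -/
lemma tendsto_log_atTop_of_logDeriv {y y' : ℝ → ℝ} {x₀ κ : ℝ}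
    (hy : ∀ x > x₀, HasDerivAt y (y' x) x) (hne : ∀ᶠ x in atTop, y x ≠ 0) (hκ : 0 < κ)
    (hlim : Tendsto (fun x => x * y' x / y x) atTop (𝓝 κ)) :
    Tendsto (fun x => Real.log (y x)) atTop atTop := by
  obtain ⟨a, ha⟩ := eventually_atTop.1 (((hne.and (eventually_gt_atTop x₀)).and
    (eventually_ge_atTop 1)).and (hlim.eventually_const_le (show κ / 2 < κ by linarith)))
  have hmono : MonotoneOn (fun x => Real.log (y x) - κ / 2 * Real.log x) (Set.Ici a) := by
    refine monotoneOn_Ici_of_hasDerivAt (f' := fun x => y' x / y x - κ / 2 * x⁻¹)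
      (fun x hx => ?_) fun x hx => ?_
    · obtain ⟨⟨⟨h1, h2⟩, h3⟩, -⟩ := ha x hx
      exact ((hy x h2).log h1).sub ((Real.hasDerivAt_log (by linarith)).const_mul _)
    · obtain ⟨⟨⟨h1, h2⟩, h3⟩, h4⟩ := ha x hx
      have hx0 : 0 < x := by linarith
      have : y' x / y x - κ / 2 * x⁻¹ = (x * y' x / y x - κ / 2) / x := by field_simp
      rw [this]
      exact div_nonneg (by linarith) hx0.le
  have hlog : Tendsto (fun x => (Real.log (y a) - κ / 2 * Real.log a) + κ / 2 * Real.log x)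
      atTop atTop :=
    tendsto_atTop_add_const_left _ _ (Real.tendsto_log_atTop.const_mul_atTop (by positivity))
  refine tendsto_atTop_mono' _ ?_ hlog
  filter_upwards [eventually_ge_atTop a] with x hx
  have := hmono Set.self_mem_Ici hx hx
  simp only at this
  linarith

/-- If κ > 0 then |y| would tend to infinity, and if κ < 0 then 1/|y| would. -/
lemma logDeriv_limit_eq_zero {y y' : ℝ → ℝ} {x₀ κ c : ℝ}
    (hy : ∀ x > x₀, HasDerivAt y (y' x) x) (hc : c ≠ 0) (hyc : Tendsto y atTop (𝓝 c))
    (hlim : Tendsto (fun x => x * y' x / y x) atTop (𝓝 κ)) : κ = 0 := by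
  have hne : ∀ᶠ x in atTop, y x ≠ 0 := hyc.eventually_ne hc
  have hlog : Tendsto (fun x => Real.log (y x)) atTop (𝓝 (Real.log c)) := hyc.log hc
  rcases lt_trichotomy κ 0 with h | h | h
  · exfalso
    obtain ⟨a, ha⟩ := eventually_atTop.1 (hne.and (eventually_gt_atTop x₀))
    have h1 := tendsto_log_atTop_of_logDeriv (y := fun x => (y x)⁻¹)
      (y' := fun x => -y' x / y x ^ 2) (x₀ := a)
      (fun x hx => ((hy x (ha x hx.le).2).inv (ha x hx.le).1))
      (hne.mono fun x hx => inv_ne_zero hx) (neg_pos.2 h) (by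
        refine hlim.neg.congr' (hne.mono fun x hx => ?_)
        field_simp)
    refine not_tendsto_nhds_of_tendsto_atTop h1 (-Real.log c) (hlog.neg.congr fun x => ?_)
    rw [Real.log_inv]
  · exact h
  · exact absurd hlog
      (not_tendsto_nhds_of_tendsto_atTop (tendsto_log_atTop_of_logDeriv hy hne h hlim) _)

variable {Y : ℕ → ℝ → ℝ} {x₀ : ℝ} {c : ℕ → ℝ}

/-- The quotient x Y_{j+1}/Y_j has the nonzero limit c j, so its logarithmic derivative times x,
which tends to 1 + c (j+1) − c j, has limit zero. -/
lemma exponent_succ (hY : ∀ j, ∀ x > x₀, HasDerivAt (Y j) (Y (j + 1) x) x)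
    (hne : ∀ j, ∀ᶠ x in atTop, Y j x ≠ 0)
    (hc : ∀ j, Tendsto (fun x => x * Y (j + 1) x / Y j x) atTop (𝓝 (c j))) {j : ℕ}
    (hj : c j ≠ 0) : c (j + 1) = c j - 1 := by
  obtain ⟨a, ha⟩ := eventually_atTop.1 (((hne j).and (hne (j + 1))).and (eventually_gt_atTop x₀))
  have h := logDeriv_limit_eq_zero (y := fun x => x * Y (j + 1) x / Y j x) (x₀ := a)
    (κ := 1 + c (j + 1) - c j)
    (y' := fun x => ((1 * Y (j + 1) x + x * Y (j + 2) x) * Y j x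
      - x * Y (j + 1) x * Y (j + 1) x) / Y j x ^ 2)
    (fun x hx => by
      obtain ⟨⟨h1, h2⟩, h3⟩ := ha x hx.le
      exact ((hasDerivAt_id x).mul (hY (j + 1) x h3)).div (hY j x h3) h1) hj (hc j) (by
      refine ((tendsto_const_nhds.add (hc (j + 1))).sub (hc j)).congr' ?_
      filter_upwards [eventually_ge_atTop a, eventually_gt_atTop 0] with x hx hx0
      obtain ⟨⟨h1, h2⟩, h3⟩ := ha x hx
      field_simp)
  linarith

lemma tendsto_pow_mul_div (hne : ∀ j, ∀ᶠ x in atTop, Y j x ≠ 0)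
    (hc : ∀ j, Tendsto (fun x => x * Y (j + 1) x / Y j x) atTop (𝓝 (c j))) (j : ℕ) :
    Tendsto (fun x => x ^ j * Y j x / Y 0 x) atTop (𝓝 (∏ m ∈ Finset.range j, c m)) := by
  induction j with
  | zero =>
    simp only [pow_zero, one_mul, Finset.range_zero, Finset.prod_empty]
    refine tendsto_const_nhds.congr' ((hne 0).mono fun x hx => (div_self hx).symm)
  | succ j ih =>
    rw [Finset.prod_range_succ]
    refine (ih.mul (hc j)).congr' ?_
    filter_upwards [hne j, hne 0] with x h1 h2
    field_simp
    ring

lemma abs_sub_le_of_abs_deriv_le {φ φ' ψ ψ' : ℝ → ℝ} {a ε : ℝ}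
    (hφ : ∀ x ≥ a, HasDerivAt φ (φ' x) x) (hψ : ∀ x ≥ a, HasDerivAt ψ (ψ' x) x)
    (h : ∀ x ≥ a, |φ' x| ≤ ε * ψ' x) {x y : ℝ} (hx : a ≤ x) (hxy : x ≤ y) :
    |φ y - φ x| ≤ ε * (ψ y - ψ x) := by
  have h1 : MonotoneOn (fun x => ε * ψ x - φ x) (Set.Ici a) :=
    monotoneOn_Ici_of_hasDerivAt (fun x hx => ((hψ x hx).const_mul ε).sub (hφ x hx))
      fun x hx => by linarith [le_abs_self (φ' x), h x hx]
  have h2 : MonotoneOn (fun x => ε * ψ x + φ x) (Set.Ici a) :=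
    monotoneOn_Ici_of_hasDerivAt (fun x hx => ((hψ x hx).const_mul ε).add (hφ x hx))
      fun x hx => by linarith [neg_abs_le (φ' x), h x hx]
  have h1' := h1 hx (hx.trans hxy : a ≤ y) hxy
  have h2' := h2 hx (hx.trans hxy : a ≤ y) hxy
  simp only at h1' h2'
  rw [abs_le]
  constructor <;> linarith

/-- On [a, N] the slope is at least ψ'(N), so a fibre of ⌊ψ⌋ has at most 1/ψ'(N) + 1 points.
Multiplied by M N ≤ ψ(N) + 1 this is O(N): xψ'/ψ ≥ c/2 gives ψ/ψ' ≤ 2N/c, which dominates 1/ψ' and ψ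
since eventually ψ ≥ 1 ≥ ψ'. -/
lemma evenlySpread_floor {ψ ψ' : ℝ → ℝ} {a c : ℝ} (hψ : ∀ x ≥ a, HasDerivAt ψ (ψ' x) x)
    (hpos : ∀ x ≥ a, 0 < ψ x) (hpos' : ∀ x ≥ a, 0 < ψ' x) (hanti : AntitoneOn ψ' (Set.Ici a))
    (htop : Tendsto ψ atTop atTop) (hψ'0 : Tendsto ψ' atTop (𝓝 0)) (hc : 0 < c)
    (hlim : Tendsto (fun x => x * ψ' x / ψ x) atTop (𝓝 c)) :
    EvenlySpread fun n => ⌊ψ n⌋₊ := by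
  have hmono := monotoneOn_Ici_of_hasDerivAt hψ fun x hx => (hpos' x hx).le
  have hcast := tendsto_natCast_atTop_atTop (R := ℝ)
  refine ⟨6 / c + 1, ⌈a⌉₊, fun N => ⌊ψ N⌋₊ + 1, by positivity,
    tendsto_atTop_mono (fun N => Nat.le_succ _) (tendsto_nat_floor_atTop.comp (htop.comp hcast)), ?_⟩
  filter_upwards [hcast.eventually_ge_atTop a, hcast.eventually (htop.eventually_ge_atTop 1),
    hcast.eventually (hψ'0.eventually_le_const zero_lt_one),
    hcast.eventually (hlim.eventually_const_le (show c / 2 < c by linarith)),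
    hcast.eventually_ge_atTop 1] with N h1 h2 h3 h4 hN1
  have hmem : ∀ n ∈ Finset.Ico ⌈a⌉₊ N, a ≤ (n : ℝ) ∧ (n : ℝ) ≤ N := fun n hn => by
    rw [Finset.mem_Ico] at hn
    exact ⟨(Nat.le_ceil a).trans (by exact_mod_cast hn.1), by exact_mod_cast hn.2.le⟩
  constructor
  · intro n hn
    obtain ⟨h5, h6⟩ := hmem n hn
    exact Nat.lt_succ_of_le (Nat.floor_le_floor (hmono h5 h1 h6))
  · intro m
    have hN' := hpos' N h1
    have hcard : (((Finset.Ico ⌈a⌉₊ N).filter fun n : ℕ => ⌊ψ n⌋₊ = m).card : ℝ)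
        ≤ 1 / ψ' N + 1 := by
      refine card_le_of_forall_sub_le (by positivity) fun p hp q hq hpq => ?_
      simp only [Finset.mem_filter] at hp hq
      obtain ⟨h5, h6⟩ := hmem p hp.1
      obtain ⟨h7, h8⟩ := hmem q hq.1
      have h9 : (p : ℝ) ≤ q := by exact_mod_cast hpq
      have h10 : ψ' N * q - ψ q ≤ ψ' N * p - ψ p := by
        have : MonotoneOn (fun x => ψ x - ψ' N * x) (Set.Icc a N) :=
          monotoneOn_of_hasDerivWithinAt_nonneg (convex_Icc a N)
            (f' := fun x => ψ' x - ψ' N * 1)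
            (fun x hx => ((hψ x hx.1).continuousAt.sub
              (continuousAt_const.mul continuousAt_id)).continuousWithinAt)
            (fun x hx => ((hψ x (interior_subset hx).1).sub
              ((hasDerivAt_id x).const_mul (ψ' N))).hasDerivWithinAt)
            fun x hx => by
              have hx' := interior_subset hx
              have := hanti hx'.1 h1 hx'.2
              linarith
        have := this ⟨h5, h6⟩ ⟨h7, h8⟩ h9
        simp only at this
        linarith
      have h11 : ψ q < m + 1 := by
        rw [← hq.2]; exact Nat.lt_floor_add_one _
      have h12 : (m : ℝ) ≤ ψ p := by
        rw [← hp.2]; exact Nat.floor_le (hpos p h5).le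
      rw [le_div_iff₀ hN']
      nlinarith
    have hM : ((⌊ψ N⌋₊ + 1 : ℕ) : ℝ) ≤ ψ N + 1 := by
      push_cast
      linarith [Nat.floor_le (hpos N h1).le]
    have hψN := hpos N h1
    have h13 : ψ N / ψ' N ≤ 2 * N / c := by
      rw [div_le_div_iff₀ hN' hc]
      rw [le_div_iff₀ hψN] at h4
      linarith
    have h14 : ψ N ≤ ψ N / ψ' N := by
      rw [le_div_iff₀ hN']
      nlinarith
    have h15 : 1 / ψ' N ≤ ψ N / ψ' N := by gcongr
    calc _ ≤ (1 / ψ' N + 1) * (ψ N + 1) := by gcongr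
      _ = ψ N / ψ' N + 1 / ψ' N + ψ N + 1 := by ring
      _ ≤ 2 * N / c + 2 * N / c + 2 * N / c + N := by linarith
      _ = _ := by ring

/-- The new time is m = ψ(t m), with τ n = ⌊ψ n⌋. Passing from n to t (τ n) moves ψ by less than 1,
and the other φ i by no more, because their derivatives are eventually dominated by ψ'. -/
lemma hasTimeChange_of_regular {ℓ : ℕ} {φ φ' : Fin ℓ → ℝ → ℝ} {i₀ : Fin ℓ} {σ a c : ℝ}
    {ψ ψ' : ℝ → ℝ} (hσ : |σ| = 1) (hφψ : ∀ x, φ i₀ x = σ * ψ x)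
    (hψ : ∀ x ≥ a, HasDerivAt ψ (ψ' x) x)
    (hpos : ∀ x ≥ a, 0 < ψ x) (hpos' : ∀ x ≥ a, 0 < ψ' x) (hanti : AntitoneOn ψ' (Set.Ici a))
    (htop : Tendsto ψ atTop atTop) (hψ'0 : Tendsto ψ' atTop (𝓝 0)) (hc : 0 < c)
    (hlim : Tendsto (fun x => x * ψ' x / ψ x) atTop (𝓝 c))
    (hφ : ∀ i, ∀ x ≥ a, HasDerivAt (φ i) (φ' i x) x)
    (hφ' : ∀ i, i ≠ i₀ → ∀ ε > 0, ∀ᶠ x in atTop, |φ' i x| ≤ ε * ψ' x) : HasTimeChange φ i₀ := by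
  have hmono := monotoneOn_Ici_of_hasDerivAt hψ fun x hx => (hpos' x hx).le
  have hcont : ContinuousOn ψ (Set.Ici a) := fun x hx => (hψ x hx).continuousAt.continuousWithinAt
  have hcast := tendsto_natCast_atTop_atTop (R := ℝ)
  have hsurj : ∀ m : ℕ, ∃ x, ψ a ≤ m → a ≤ x ∧ ψ x = m := fun m => by
    by_cases hm : ψ a ≤ m
    · obtain ⟨b, hb, hba⟩ := ((htop.eventually_ge_atTop (m : ℝ)).and (eventually_ge_atTop a)).exists
      obtain ⟨x, hx, hxm⟩ := isPreconnected_Ici.intermediate_value Set.self_mem_Ici hba hcont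
        ⟨hm, hb⟩
      exact ⟨x, fun _ => ⟨hx, hxm⟩⟩
    · exact ⟨0, fun h => absurd h hm⟩
  choose t ht using hsurj
  have hlarge : ∀ᶠ m : ℕ in atTop, ψ a ≤ m := hcast.eventually_ge_atTop _
  have ht_top : Tendsto t atTop atTop := by
    refine tendsto_atTop.2 fun K => ?_
    filter_upwards [hlarge, hcast.eventually_gt_atTop (ψ (max K a))] with m h1 h2
    obtain ⟨h3, h4⟩ := ht m h1
    by_contra hlt
    have := hmono h3 (le_max_right K a) ((not_le.1 hlt).le.trans (le_max_left K a))
    linarith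
  have hsmall : ∀ ε > 0, ∀ᶠ b in atTop, ∀ i, i ≠ i₀ → ∀ x y, b ≤ x → x ≤ y →
      |φ i y - φ i x| ≤ ε * (ψ y - ψ x) := fun ε hε => by
    rw [eventually_all]
    intro i
    by_cases hi : i = i₀
    · simp [hi]
    · obtain ⟨b, hb⟩ := eventually_atTop.1 (hφ' i hi ε hε)
      filter_upwards [eventually_ge_atTop (max a b)] with b' hb' _ x y hx hxy
      have hab := max_le_iff.1 hb'
      exact abs_sub_le_of_abs_deriv_le (fun x hx => hφ i x (hab.1.trans hx))
        (fun x hx => hψ x (hab.1.trans hx)) (fun x hx => hb x (hab.2.trans hx)) hx hxy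
  have hτ_top : Tendsto (fun n : ℕ => ⌊ψ n⌋₊) atTop atTop :=
    tendsto_nat_floor_atTop.comp (htop.comp hcast)
  refine ⟨t, fun n => ⌊ψ n⌋₊, σ, fun h => by simp [h] at hσ,
    evenlySpread_floor hψ hpos hpos' hanti htop hψ'0 hc hlim, ?_, fun h => ?_, fun h => ?_⟩
  · filter_upwards [hτ_top.eventually hlarge,
      (ht_top.comp hτ_top).eventually (hsmall 1 one_pos), hcast.eventually_ge_atTop a]
      with n h1 h2 h3 i
    obtain ⟨h4, h5⟩ := ht _ h1
    have h6 := Nat.floor_le (hpos n h3).le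
    have h7 := Nat.lt_floor_add_one (ψ n)
    rcases eq_or_ne i i₀ with rfl | hi
    · rw [hφψ, hφψ, ← mul_sub, abs_mul, hσ, one_mul, h5, abs_le]
      constructor <;> linarith
    · have h8 : t ⌊ψ n⌋₊ ≤ n := by
        by_contra hlt
        have hlt := not_le.1 hlt
        have heq : ψ n = ψ (t ⌊ψ n⌋₊) := le_antisymm (hmono h3 h4 hlt.le) (by rw [h5]; exact h6)
        obtain ⟨ξ, hξ, hξ'⟩ := exists_hasDerivAt_eq_slope ψ ψ' hlt
          (hcont.mono (Set.Icc_subset_Ici_iff hlt.le |>.2 h3))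
          fun x hx => hψ x (h3.trans hx.1.le)
        have := hpos' ξ (h3.trans hξ.1.le)
        rw [hξ', ← heq, sub_self, zero_div] at this
        exact lt_irrefl _ this
      have h9 := h2 i hi _ _ le_rfl h8
      simp only [Function.comp] at h9
      rw [h5] at h9
      linarith
  · have hh : (0 : ℝ) < 1 / (h + 1) := by positivity
    filter_upwards [hlarge, ht_top.eventually (hsmall _ hh)] with m h1 h2 i hi
    have h1' : ψ a ≤ ((m + h : ℕ) : ℝ) := by push_cast; linarith [(h.cast_nonneg : (0 : ℝ) ≤ h)]
    obtain ⟨h3, h4⟩ := ht m h1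
    obtain ⟨h5, h6⟩ := ht (m + h) h1'
    have h7 : t m ≤ t (m + h) := by
      by_contra hlt
      have hlt := not_le.1 hlt
      have heq : ψ (t (m + h)) = ψ (t m) := le_antisymm (hmono h5 h3 hlt.le) (by
        rw [h4, h6]; push_cast; linarith [(h.cast_nonneg : (0 : ℝ) ≤ h)])
      obtain ⟨ξ, hξ, hξ'⟩ := exists_hasDerivAt_eq_slope ψ ψ' hlt
        (hcont.mono (Set.Icc_subset_Ici_iff hlt.le |>.2 h5))
        fun x hx => hψ x (h5.trans hx.1.le)
      have := hpos' ξ (h5.trans hξ.1.le)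
      rw [hξ', heq, sub_self, zero_div] at this
      exact lt_irrefl _ this
    refine (h2 i hi _ _ le_rfl h7).trans ?_
    rw [h4, h6]
    push_cast
    rw [add_sub_cancel_left, div_mul_eq_mul_div, one_mul, div_le_one (by positivity)]
    linarith
  · filter_upwards [hlarge] with m h1
    have h1' : ψ a ≤ ((m + h : ℕ) : ℝ) := by push_cast; linarith [(h.cast_nonneg : (0 : ℝ) ≤ h)]
    rw [hφψ, hφψ, (ht m h1).2, (ht _ h1').2]
    push_cast
    ring

end Regularity

/-! ### Derivatives of tempered functions -/

section Tempered

lemma ClassR.exists_hasDerivAt {g : ℝ → ℝ} (hg : ClassR g) : ∃ x₀ : ℝ, ∀ j, ∀ x > x₀,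
    HasDerivAt (iteratedDeriv j g) (iteratedDeriv (j + 1) g x) x := by
  obtain ⟨⟨x₀, hx₀⟩, -⟩ := hg
  refine ⟨x₀, fun j x hx => ?_⟩
  have h1 : ContDiffOn ℝ ∞ g (Set.Ioi x₀) := hx₀.mono Set.Ioi_subset_Ici_self
  have h2 := h1.differentiableOn_iteratedDerivWithin (m := j)
    (by exact_mod_cast WithTop.coe_lt_top _) isOpen_Ioi.uniqueDiffOn
  have h3 : DifferentiableOn ℝ (iteratedDeriv j g) (Set.Ioi x₀) :=
    h2.congr fun y hy => (iteratedDerivWithin_of_isOpen isOpen_Ioi hy).symm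
  have h4 := (h3.differentiableAt (isOpen_Ioi.mem_nhds hx)).hasDerivAt
  rwa [← iteratedDeriv_succ] at h4

lemma ClassR.eventually_ne_zero {g : ℝ → ℝ} (hg : ClassR g) : ∀ᶠ x in atTop, g x ≠ 0 := by
  simpa using (hg.2 0).1

lemma ClassT.classR {g : ℝ → ℝ} (hg : ClassT g) : ClassR g := by
  obtain ⟨i, hi⟩ := hg
  exact hi.1

lemma GrowsSlower.trans {f g h : ℝ → ℝ} (hg : ∀ᶠ x in atTop, g x ≠ 0) (h1 : GrowsSlower f g)
    (h2 : GrowsSlower g h) : GrowsSlower f h := by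
  refine (h2.atTop_mul_atTop₀ h1).congr' (hg.mono fun x hx => ?_)
  have : |g x| ≠ 0 := abs_ne_zero.2 hx
  field_simp

lemma growsSlower_of_lt {ℓ : ℕ} {g : Fin ℓ → ℝ → ℝ} (hg : ∀ i, ∀ᶠ x in atTop, g i x ≠ 0)
    (hgrowth : ∀ i j : Fin ℓ, (i : ℕ) + 1 = (j : ℕ) → GrowsSlower (g j) (g i)) {i j : Fin ℓ}
    (hij : i < j) : GrowsSlower (g j) (g i) := by
  obtain ⟨n, hn⟩ : ∃ n, (j : ℕ) = i + (n + 1) := ⟨j - i - 1, by have : (i : ℕ) < j := hij; omega⟩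
  induction n generalizing j with
  | zero => exact hgrowth i j (by omega)
  | succ n ih =>
    have hk : (i : ℕ) + (n + 1) < ℓ := by have := j.2; omega
    have h1 := ih (j := ⟨i + (n + 1), hk⟩) (Fin.lt_def.2 (by simp)) rfl
    exact GrowsSlower.trans (hg _) (hgrowth _ j (by simp only; omega)) h1

lemma GrowsSlower.tendsto_div {f g : ℝ → ℝ} (h : GrowsSlower f g) :
    Tendsto (fun x => f x / g x) atTop (𝓝 0) := by
  rw [tendsto_zero_iff_abs_tendsto_zero]
  refine (tendsto_inv_atTop_zero.comp h).congr fun x => ?_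
  simp [abs_div]

/-- Each differentiation lowers the exponent by one as long as it is nonzero, so c j = α − j, and α
> e. -/
lemma ClassTDeg.exponent {e : ℕ} {g : ℝ → ℝ} (hg : ClassTDeg e g) {c : ℕ → ℝ}
    (hc : ∀ j, Tendsto (fun x : ℝ => x * iteratedDeriv (j + 1) g x / iteratedDeriv j g x)
      atTop (𝓝 (c j))) {j : ℕ} (hj : j ≤ e) : 0 < c j := by
  obtain ⟨hR, ⟨α, hα, -, hlim⟩, -⟩ := hg
  obtain ⟨x₀, hx₀⟩ := hR.exists_hasDerivAt
  have h0 : c 0 = α := by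
    have := hc 0
    simp only [zero_add, iteratedDeriv_one, iteratedDeriv_zero] at this
    exact tendsto_nhds_unique this hlim
  have key : ∀ j ≤ e, c j = α - j := fun j => by
    induction j with
    | zero => intro _; simp [h0]
    | succ j ih =>
      intro hj
      have hij := ih (by omega)
      have hje : (j : ℝ) + 1 ≤ e := by exact_mod_cast hj
      rw [exponent_succ hx₀ (fun j => (hR.2 j).1) hc (by rw [hij]; linarith), hij]
      push_cast
      ring
  rw [key j hj]
  have : (j : ℝ) ≤ e := by exact_mod_cast hj
  linarith

/-- Both x^{e+1} f^{(e+1)}/f and x^{e+1} g^{(e+1)}/g have finite limits, and the second is nonzero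
because the exponents of g up to order e are positive. The relation f ≺ g thus passes to the
derivatives. -/
lemma tendsto_iteratedDeriv_div {f g : ℝ → ℝ} (hf : ClassR f) {e : ℕ} (hg : ClassTDeg e g)
    (hfg : GrowsSlower f g) :
    Tendsto (fun x => iteratedDeriv (e + 1) f x / iteratedDeriv (e + 1) g x) atTop (𝓝 0) := by
  have hgR := hg.1
  choose a ha using fun j => (hf.2 j).2
  choose c hc using fun j => (hgR.2 j).2
  have h1 := tendsto_pow_mul_div (fun j => (hf.2 j).1) ha (e + 1)
  have h2 := tendsto_pow_mul_div (fun j => (hgR.2 j).1) hc (e + 1)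
  have hprod : ∏ m ∈ Finset.range (e + 1), c m ≠ 0 := Finset.prod_ne_zero_iff.2 fun m hm =>
    (hg.exponent hc (Nat.lt_succ_iff.1 (Finset.mem_range.1 hm))).ne'
  have h3 := (h1.div h2 hprod).mul hfg.tendsto_div
  rw [mul_zero] at h3
  refine h3.congr' ?_
  filter_upwards [hf.eventually_ne_zero, hgR.eventually_ne_zero, (hgR.2 (e + 1)).1,
    eventually_gt_atTop 0] with x h4 h5 h6 h7
  simp only [iteratedDeriv_zero, Pi.div_apply]
  field_simp

/-- The derivatives of the functions `g i`, `i₀ ≤ i`; the other functions are replaced by zero. -/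
noncomputable def derivSystem {ℓ : ℕ} (g : Fin ℓ → ℝ → ℝ) (i₀ i : Fin ℓ) (j : ℕ) (x : ℝ) : ℝ :=
  if i < i₀ then 0 else iteratedDeriv j (g i) x

lemma exists_hasDerivAt_derivSystem {ℓ : ℕ} {g : Fin ℓ → ℝ → ℝ} (hg : ∀ i, ClassR (g i))
    (i₀ : Fin ℓ) : ∃ x₀ : ℝ, ∀ i j, ∀ x > x₀,
      HasDerivAt (derivSystem g i₀ i j) (derivSystem g i₀ i (j + 1) x) x := by
  choose y hy using fun i => (hg i).exists_hasDerivAt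
  obtain ⟨x₀, hx₀⟩ := (Set.finite_range y).bddAbove
  refine ⟨x₀, fun i j x hx => ?_⟩
  unfold derivSystem
  by_cases h : i < i₀
  · simpa [h] using hasDerivAt_const x (0 : ℝ)
  · simpa [h] using hy i j x (lt_of_le_of_lt (hx₀ ⟨i, rfl⟩) hx)

variable {ℓ : ℕ} {g : Fin ℓ → ℝ → ℝ}

lemma eventually_abs_derivSystem_le (hg : ∀ i, ClassR (g i)) {i₀ : Fin ℓ} {e : ℕ}
    (he : ClassTDeg e (g i₀)) (hgrowth : ∀ i, i₀ < i → GrowsSlower (g i) (g i₀)) {i : Fin ℓ}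
    (hi : i ≠ i₀) {ε : ℝ} (hε : 0 < ε) :
    ∀ᶠ x in atTop, |derivSystem g i₀ i (e + 1) x| ≤ ε * |iteratedDeriv (e + 1) (g i₀) x| := by
  rcases lt_or_gt_of_ne hi with h | h
  · refine .of_forall fun x => ?_
    simp only [derivSystem, h, if_true, abs_zero]
    positivity
  · have hlim := (tendsto_iteratedDeriv_div (hg i) he (hgrowth i h)).abs
    rw [abs_zero] at hlim
    filter_upwards [hlim.eventually_le_const hε, (he.1.2 (e + 1)).1] with x h1 h2
    rw [abs_div, div_le_iff₀ (abs_pos.2 h2)] at h1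
    simpa only [derivSystem, h.not_gt, if_false] using h1

lemma hasTimeChange_derivSystem (hg : ∀ i, ClassR (g i)) {i₀ : Fin ℓ} {e : ℕ}
    (he : ClassTDeg e (g i₀)) (hgrowth : ∀ i, i₀ < i → GrowsSlower (g i) (g i₀)) :
    HasTimeChange (fun i => derivSystem g i₀ i e) i₀ := by
  obtain ⟨x₀, hD⟩ := exists_hasDerivAt_derivSystem hg i₀
  have hne : ∀ j, ∀ᶠ x in atTop, iteratedDeriv j (g i₀) x ≠ 0 := fun j => (he.1.2 j).1
  choose c hc using fun j => (he.1.2 j).2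
  have hce := he.exponent hc le_rfl
  have hYD : ∀ j, derivSystem g i₀ i₀ j = iteratedDeriv j (g i₀) := fun j => by
    funext x; simp [derivSystem]
  have hY : ∀ j, ∀ x > x₀,
      HasDerivAt (iteratedDeriv j (g i₀)) (iteratedDeriv (j + 1) (g i₀) x) x := fun j x hx => by
    have := hD i₀ j x hx
    rwa [hYD, hYD] at this
  obtain ⟨σ, hσ, hpos⟩ : ∃ σ : ℝ, (σ = 1 ∨ σ = -1) ∧
      ∀ᶠ x in atTop, 0 < σ * iteratedDeriv e (g i₀) x := by
    rcases eventually_pos_or_neg (fun x hx => (hY e x hx).continuousAt) (hne e) with h | h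
    · exact ⟨1, .inl rfl, by simpa using h⟩
    · exact ⟨-1, .inr rfl, by simpa using h⟩
  have hσ1 : |σ| = 1 := by rcases hσ with rfl | rfl <;> simp
  have hσσ : σ * σ = 1 := by rcases hσ with rfl | rfl <;> norm_num
  have hσ0 : σ ≠ 0 := fun h => by simp [h] at hσσ
  have hψ : ∀ j, ∀ x > x₀, HasDerivAt (fun x => σ * iteratedDeriv j (g i₀) x)
      (σ * iteratedDeriv (j + 1) (g i₀) x) x := fun j x hx => (hY j x hx).const_mul σ
  have hlim : Tendsto (fun x => x * (σ * iteratedDeriv (e + 1) (g i₀) x) /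
      (σ * iteratedDeriv e (g i₀) x)) atTop (𝓝 (c e)) :=
    (hc e).congr fun x => by
      rw [mul_left_comm, mul_div_mul_left _ _ hσ0]
  -- The exponent of the e-th derivative is positive, which forces growth to infinity.
  have htop : Tendsto (fun x => σ * iteratedDeriv e (g i₀) x) atTop atTop := by
    have := Real.tendsto_exp_atTop.comp
      (tendsto_log_atTop_of_logDeriv (hψ e) (hpos.mono fun x hx => hx.ne') hce hlim)
    exact this.congr' (hpos.mono fun x hx => Real.exp_log hx)
  have h0 : Tendsto (fun x => σ * iteratedDeriv (e + 1) (g i₀) x) atTop (𝓝 0) := by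
    simpa using he.2.2.const_mul σ
  have hpos' : ∀ᶠ x in atTop, 0 < σ * iteratedDeriv (e + 1) (g i₀) x := by
    filter_upwards [hlim.eventually_const_lt hce, hpos, eventually_gt_atTop 0] with x h1 h2 h3
    have := (div_pos_iff_of_pos_right h2).1 h1
    exact (mul_pos_iff_of_pos_left h3).1 this
  -- Were ψ'' eventually positive, the positive function ψ' would increase and could not tend to
  -- zero.
  have hneg : ∀ᶠ x in atTop, σ * iteratedDeriv (e + 2) (g i₀) x < 0 := by
    refine (eventually_pos_or_neg (fun x hx => (hψ (e + 2) x hx).continuousAt)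
      ((hne (e + 2)).mono fun x hx => mul_ne_zero hσ0 hx)).resolve_left fun hp => ?_
    obtain ⟨a, ha⟩ := eventually_atTop.1 ((hp.and hpos').and (eventually_gt_atTop x₀))
    have hmono := monotoneOn_Ici_of_hasDerivAt (fun x hx => hψ (e + 1) x (ha x hx).2)
      fun x hx => (ha x hx).1.1.le
    obtain ⟨x, hx, hxa⟩ := ((h0.eventually_lt_const (ha a le_rfl).1.2).and
      (eventually_ge_atTop a)).exists
    exact absurd (hmono Set.self_mem_Ici hxa hxa) (not_le.2 hx)
  obtain ⟨a, ha⟩ := eventually_atTop.1 (((hpos.and hpos').and hneg).and (eventually_gt_atTop x₀))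
  have hanti : AntitoneOn (fun x => σ * iteratedDeriv (e + 1) (g i₀) x) (Set.Ici a) := by
    have := monotoneOn_Ici_of_hasDerivAt (fun x hx => (hψ (e + 1) x (ha x hx).2).neg)
      fun x hx => (neg_pos.2 (ha x hx).1.2).le
    simpa using this.neg
  refine hasTimeChange_of_regular (φ' := fun i => derivSystem g i₀ i (e + 1)) hσ1 (fun x => ?_)
    (fun x hx => hψ e x (ha x hx).2) (fun x hx => (ha x hx).1.1.1)
    (fun x hx => (ha x hx).1.1.2) hanti htop h0 hce hlim (fun i x hx => hD i e x (ha x hx).2)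
    fun i hi ε hε => ?_
  · rw [hYD, ← mul_assoc, hσσ, one_mul]
  · filter_upwards [eventually_abs_derivSystem_le hg he hgrowth hi hε, hpos'] with x h1 h2
    have : |iteratedDeriv (e + 1) (g i₀) x| = σ * iteratedDeriv (e + 1) (g i₀) x := by
      rw [← abs_of_pos h2, abs_mul, hσ1, one_mul]
    rwa [this] at h1

lemma exists_derivSystem (hg : ∀ i, ClassT (g i))
    (hgrowth : ∀ i j : Fin ℓ, (i : ℕ) + 1 = (j : ℕ) → GrowsSlower (g j) (g i)) (i₀ : Fin ℓ) :
    ∃ (e : ℕ) (x₀ : ℝ), (∀ i j, ∀ x > x₀,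
      HasDerivAt (derivSystem g i₀ i j) (derivSystem g i₀ i (j + 1) x) x) ∧
      (∀ i, ∀ x > x₀, |derivSystem g i₀ i (e + 1) x| ≤ 1) ∧
      HasTimeChange (fun i => derivSystem g i₀ i e) i₀ := by
  have hR := fun i => (hg i).classR
  have hgr : ∀ i, i₀ < i → GrowsSlower (g i) (g i₀) := fun i hi =>
    growsSlower_of_lt (fun i => (hR i).eventually_ne_zero) hgrowth hi
  obtain ⟨e, he⟩ := hg i₀
  obtain ⟨x₀, hD⟩ := exists_hasDerivAt_derivSystem hR i₀
  have h1 : ∀ᶠ x in atTop, |iteratedDeriv (e + 1) (g i₀) x| ≤ 1 := by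
    have := he.2.2.abs
    rw [abs_zero] at this
    exact this.eventually_le_const one_pos
  have h2 : ∀ i, ∀ᶠ x in atTop, |derivSystem g i₀ i (e + 1) x| ≤ 1 := fun i => by
    rcases eq_or_ne i i₀ with rfl | hi
    · simpa [derivSystem] using h1
    · filter_upwards [h1, eventually_abs_derivSystem_le hR he hgr hi one_pos] with x h3 h4
      linarith
  obtain ⟨a, ha⟩ := eventually_atTop.1 (eventually_all.2 h2)
  exact ⟨e, max a x₀, fun i j x hx => hD i j x ((le_max_right _ _).trans_lt hx),
    fun i x hx => ha x ((le_max_left _ _).trans hx.le) i, hasTimeChange_derivSystem hR he hgr⟩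

end Tempered

/-! ### L² convergence and the telescoping argument -/

section Conclusion

variable {X : Type*} [MeasurableSpace X] {μ : Measure X}

lemma UNull.zero : UNull μ fun _ _ => 0 := by
  intro ε hε
  filter_upwards with N F _ _
  simp only [mul_zero, integral_zero, norm_zero, Finset.sum_const_zero]
  positivity

lemma UNull.add [IsFiniteMeasure μ] {u v : ℕ → X → ℂ} (hu : UNull μ u) (hv : UNull μ v)
    (hub : ∀ n, BddMeas (u n)) (hvb : ∀ n, BddMeas (v n)) :
    UNull μ fun n x => u n x + v n x := by
  intro ε hε
  filter_upwards [hu (ε / 2) (by positivity), hv (ε / 2) (by positivity)] with N h1 h2 F hF hF1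
  have hb : BddMeas F := ⟨hF, 1, hF1⟩
  calc _ ≤ ∑ n ∈ Finset.range N, (‖∫ x, F x * u n x ∂μ‖ + ‖∫ x, F x * v n x ∂μ‖) := by
        refine Finset.sum_le_sum fun n _ => ?_
        simp_rw [mul_add]
        rw [integral_add (hb.mul (hub n)).integrable (hb.mul (hvb n)).integrable]
        exact norm_add_le _ _
    _ ≤ _ := by
        rw [Finset.sum_add_distrib]
        linarith [h1 F hF hF1, h2 F hF hF1]

lemma BddMeas.sum {κ : Type*} (s : Finset κ) {f : κ → X → ℂ} (hf : ∀ k ∈ s, BddMeas (f k)) :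
    BddMeas fun x => ∑ k ∈ s, f k x := by
  classical
  induction s using Finset.induction_on with
  | empty => simpa using BddMeas.const 0
  | insert a s ha ih =>
    have := (hf a (by simp)).sub
      ((BddMeas.const (-1)).mul (ih fun k hk => hf k (by simp [hk])))
    simpa [Finset.sum_insert ha] using this

lemma UNull.sum [IsFiniteMeasure μ] {κ : Type*} (s : Finset κ) {u : κ → ℕ → X → ℂ}
    (hu : ∀ k ∈ s, UNull μ (u k)) (hub : ∀ k ∈ s, ∀ n, BddMeas (u k n)) :
    UNull μ fun n x => ∑ k ∈ s, u k n x := by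
  classical
  induction s using Finset.induction_on with
  | empty => simpa using UNull.zero
  | insert a s ha ih =>
    have := (hu a (by simp)).add (ih (fun k hk => hu k (by simp [hk]))
      fun k hk => hub k (by simp [hk])) (hub a (by simp))
      fun n => .sum s fun k hk => hub k (by simp [hk]) n
    simpa [Finset.sum_insert ha] using this

lemma UNull.const_mul {u : ℕ → X → ℂ} (hu : UNull μ u) (c : ℂ) :
    UNull μ fun n x => c * u n x := by
  intro ε hε
  filter_upwards [hu (ε / (‖c‖ + 1)) (by positivity)] with N h F hF hF1
  have h1 := h F hF hF1
  simp_rw [mul_left_comm _ c, integral_const_mul, norm_mul, ← Finset.mul_sum]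
  calc _ ≤ ‖c‖ * (ε / (‖c‖ + 1) * N) := by gcongr
    _ = (‖c‖ / (‖c‖ + 1)) * (ε * N) := by ring
    _ ≤ 1 * (ε * N) := by
        gcongr
        rw [div_le_one (by positivity)]
        linarith
    _ = ε * N := one_mul _

/-- With A the average, ‖A‖² is the average of ∫ Ā uₙ, so the conjugate of A, scaled by 1/C, is the
test function. It varies with N, which is where uniformity in F is used. -/
lemma UNull.tendsto_eLpNorm [IsProbabilityMeasure μ] {u : ℕ → X → ℂ} (hu : UNull μ u) {B : ℝ}
    (hm : ∀ n, Measurable (u n)) (hB : ∀ n x, ‖u n x‖ ≤ B) :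
    Tendsto (fun N : ℕ => eLpNorm (fun x => (1 / (N : ℂ)) * ∑ n ∈ Finset.Icc 1 N, u n x) 2 μ)
      atTop (𝓝 0) := by
  set C := max B 1
  have hC : 0 < C := lt_of_lt_of_le one_pos (le_max_right _ _)
  rw [ENNReal.tendsto_nhds_zero]
  intro δ hδ
  obtain ⟨ε, hε0, hεδ⟩ : ∃ ε : ℝ, 0 < ε ∧ ENNReal.ofReal ε ≤ δ := by
    rcases eq_or_ne δ ⊤ with rfl | h
    · exact ⟨1, one_pos, le_top⟩
    · exact ⟨δ.toReal, ENNReal.toReal_pos hδ.ne' h, ENNReal.ofReal_toReal_le⟩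
  -- The factor 2 pays for summing over N + 1 ≤ 2N terms, the factor C for the scaling of the test
  -- function.
  have hη : 0 < ε ^ 2 / (2 * C) := by positivity
  filter_upwards [(tendsto_add_atTop_nat 1).eventually (hu _ hη), eventually_ge_atTop 1]
    with N hN hN1
  have hN0 : (0 : ℝ) < N := by exact_mod_cast hN1
  have hN2 : (1 : ℝ) ≤ N := by exact_mod_cast hN1
  set A : X → ℂ := fun x => (1 / (N : ℂ)) * ∑ n ∈ Finset.Icc 1 N, u n x with hA
  have hAm : Measurable A :=
    (Finset.measurable_sum _ fun n _ => hm n).const_mul _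
  have hAB : ∀ x, ‖A x‖ ≤ C := fun x => by
    rw [hA, norm_mul, norm_div, norm_one, Complex.norm_natCast, one_div, inv_mul_le_iff₀ hN0]
    refine (norm_sum_le _ _).trans ?_
    calc _ ≤ ∑ n ∈ Finset.Icc 1 N, C :=
          Finset.sum_le_sum fun n _ => (hB n x).trans (le_max_left _ _)
      _ = N * C := by simp
  have hAL : MemLp A 2 μ := BddMeas.memLp ⟨hAm, C, hAB⟩ 2
  have hF := hN (fun x => (C⁻¹ : ℝ) * (starRingEnd ℂ) (A x)) (by
      exact (Complex.continuous_conj.measurable.comp hAm).const_mul _) fun x => by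
    rw [norm_mul, RCLike.norm_conj, Complex.norm_real, Real.norm_of_nonneg (by positivity),
      inv_mul_le_iff₀ hC, mul_one]
    exact hAB x
  have hub : ∀ n, BddMeas (u n) := fun n => ⟨hm n, B, hB n⟩
  have hAb : BddMeas fun x => (starRingEnd ℂ) (A x) := BddMeas.conj ⟨hAm, C, hAB⟩
  simp_rw [mul_assoc, integral_const_mul, norm_mul, ← Finset.mul_sum] at hF
  rw [Complex.norm_real, Real.norm_of_nonneg (by positivity), inv_mul_le_iff₀ hC] at hF
  have h1 : ∑ n ∈ Finset.Icc 1 N, ‖∫ x, (starRingEnd ℂ) (A x) * u n x ∂μ‖ ≤ ε ^ 2 * N := by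
    calc _ ≤ ∑ n ∈ Finset.range (N + 1), ‖∫ x, (starRingEnd ℂ) (A x) * u n x ∂μ‖ :=
          Finset.sum_le_sum_of_subset_of_nonneg (fun n hn => by
            rw [Finset.mem_Icc] at hn
            exact Finset.mem_range.2 (by omega)) fun _ _ _ => norm_nonneg _
      _ ≤ C * (ε ^ 2 / (2 * C) * ((N + 1 : ℕ) : ℝ)) := hF
      _ = ε ^ 2 * (((N : ℝ) + 1) / 2) := by push_cast; field_simp
      _ ≤ ε ^ 2 * N := by gcongr; linarith
  have h2 : ‖hAL.toLp A‖ ^ 2 ≤ ε ^ 2 := by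
    have h3 : ‖hAL.toLp A‖ ^ 2 = ‖inner ℂ (hAL.toLp A) (hAL.toLp A)‖ := by
      rw [inner_self_eq_norm_sq_to_K]
      simp
    rw [h3, inner_toLp]
    have h4 : ∀ x, (starRingEnd ℂ) (A x) * A x =
        (1 / (N : ℂ)) * ∑ n ∈ Finset.Icc 1 N, (starRingEnd ℂ) (A x) * u n x := fun x => by
      rw [← Finset.mul_sum, mul_left_comm]
    simp_rw [h4]
    rw [integral_const_mul, integral_finsetSum _ fun n _ => (hAb.mul (hub n)).integrable, norm_mul,
      norm_div, norm_one, Complex.norm_natCast, one_div, inv_mul_le_iff₀ hN0]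
    refine (norm_sum_le _ _).trans (h1.trans_eq (mul_comm _ _))
  have h5 : ‖hAL.toLp A‖ ≤ ε := by
    exact abs_le_of_sq_le_sq' h2 hε0.le |>.2
  rw [Lp.norm_toLp] at h5
  exact ((ENNReal.le_ofReal_iff_toReal_le hAL.2.ne hε0.le).2 h5).trans hεδ

variable {ℓ : ℕ}

/-- The case where the function along the fastest sequence that occurs has mean zero. -/
lemma uNull_of_integral_eq_zero [IsProbabilityMeasure μ] {act : (Fin ℓ → ℤ) → X → X}
    (ha : PreservingAction μ act) {g : Fin ℓ → ℝ → ℝ} (hg : ∀ i, ClassT (g i))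
    (hgrowth : ∀ i j : Fin ℓ, (i : ℕ) + 1 = (j : ℕ) → GrowsSlower (g j) (g i)) {i₀ : Fin ℓ}
    (he : MixingAlong μ act (Pi.single i₀ 1)) {f : Fin ℓ → X → ℂ} (hf : ∀ i, BddMeas (f i))
    (h0 : ∫ x, f i₀ x ∂μ = 0) :
    UNull μ fun n x => ∏ i with i₀ ≤ i, f i (act (Pi.single i ⌊g i n⌋) x) := by
  obtain ⟨e, x₀, hD, hd, hT⟩ := exists_derivSystem hg hgrowth i₀
  -- Each sequence starts as the function g q itself, in its own direction. At index 0 the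
  -- difference between i₀ and any other member has entry 1 in direction i₀.
  set r : {i // i₀ ≤ i} → ℕ → Fin ℓ → ℝ := fun q j => if j = 0 then Pi.single q.1 1 else 0 with hr
  have hr0 : ∀ q, r q 0 = Pi.single q.1 1 := fun q => rfl
  have key := normGood_evalSeq ha he hD (d := e + 1) (e₀ := 0) hd hT r ⟨i₀, le_rfl⟩
    (fun q h => by
      have := congrFun (h 0 (Nat.succ_pos e)) q.1
      simp [hr0] at this)
    (fun q hq => ⟨0, Nat.succ_pos e, fun _ h => absurd h (Nat.not_lt_zero _), by
      have : q.1 ≠ i₀ := fun h => hq (Subtype.ext h)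
      simp [hr0, this.symm]⟩) (Nat.succ_pos e)
    (fun _ _ h => absurd h (Nat.not_lt_zero _)) (by simp [hr0])
  have hev : ∀ (q : {i // i₀ ≤ i}) (n : ℕ),
      evalSeq (derivSystem g i₀) (e + 1) (r q) n = Pi.single q.1 ⌊g q.1 n⌋ := fun q n => by
    funext i
    have hc : combo (derivSystem g i₀) (e + 1) (r q) i n =
        (Pi.single q.1 1 : Fin ℓ → ℝ) i * derivSystem g i₀ i 0 n := by
      rw [combo, Finset.sum_range_succ', Finset.sum_eq_zero (fun j _ => by simp [hr]), hr0, zero_add]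
    rw [evalSeq, hc]
    rcases eq_or_ne i q.1 with rfl | hi
    · simp [derivSystem, not_lt.2 q.2]
    · simp [hi]
  have h1 := key (fun q => f q.1) (fun q => hf q.1) h0
  simp only [hev] at h1
  refine (congrArg (UNull μ) (funext fun n => funext fun x => ?_)).mpr h1
  exact (Finset.prod_subtype _ (p := fun i => i₀ ≤ i) (fun i => by simp) fun i => f i (act (Pi.single i ⌊g i n⌋) x))

lemma uNull_prod_sub_prod [IsProbabilityMeasure μ] {act : (Fin ℓ → ℤ) → X → X}
    (ha : PreservingAction μ act) {g : Fin ℓ → ℝ → ℝ} (hg : ∀ i, ClassT (g i))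
    (hgrowth : ∀ i j : Fin ℓ, (i : ℕ) + 1 = (j : ℕ) → GrowsSlower (g j) (g i))
    (he : ∀ i, MixingAlong μ act (Pi.single i 1)) {f : Fin ℓ → X → ℂ} (hf : ∀ i, BddMeas (f i)) :
    UNull μ fun n x => ∏ i, f i (act (Pi.single i ⌊g i n⌋) x) - ∏ i, ∫ y, f i y ∂μ := by
  classical
  set c : Fin ℓ → ℂ := fun i => ∫ y, f i y ∂μ
  set a : ℕ → Fin ℓ → X → ℂ := fun n i x => f i (act (Pi.single i ⌊g i n⌋) x)
  have hab : ∀ n i, BddMeas (a n i) := fun n i => ha.bddMeas_comp _ (hf i)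
  -- In the i-th summand the factors faster than g i are already replaced by constants, so i is the
  -- fastest index left and its factor has mean zero.
  have hsplit : ∀ n x, ∏ i, a n i x - ∏ i, c i =
      ∑ i, (∏ j with j < i, c j) * ((a n i x - c i) * ∏ j with i < j, a n j x) := fun n x => by
    have := Finset.prod_sub_ordered Finset.univ (fun i => a n i x) fun i => a n i x - c i
    simp only [sub_sub_cancel] at this
    rw [this, sub_sub_cancel]
    exact Finset.sum_congr rfl fun i _ => by ring
  have hterm : ∀ i, UNull μ fun n x => (a n i x - c i) * ∏ j with i < j, a n j x := fun i => by
    have h1 := uNull_of_integral_eq_zero ha hg hgrowth (he i)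
      (f := Function.update f i fun x => f i x - c i) (fun j => by
        rcases eq_or_ne j i with rfl | h
        · simpa using (hf j).sub (.const _)
        · simpa [h] using hf j) (by
        simp only [Function.update_self]
        rw [integral_sub (hf i).integrable (integrable_const _)]
        simp [c])
    refine (congrArg (UNull μ) (funext fun n => funext fun x => ?_)).mpr h1
    have hs : (Finset.univ.filter fun j => i ≤ j) = insert i (Finset.univ.filter fun j => i < j) := by
      ext j
      simp [le_iff_eq_or_lt, eq_comm]
    rw [hs, Finset.prod_insert (by simp)]
    congr 1
    · simp [a]
    · refine Finset.prod_congr rfl fun j hj => ?_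
      have hne : j ≠ i := (Finset.mem_filter.1 hj).2.ne'
      simp [a, hne]
  simp only [a, c] at hsplit ⊢
  simp_rw [hsplit]
  refine UNull.sum _ (fun i _ => (hterm i).const_mul _) fun i _ n => ?_
  exact (BddMeas.const _).mul (((hab n i).sub (.const _)).mul (.prod _ fun j _ => hab n j))

lemma exists_bddMeas_ae_eq {f : X → ℂ} (hf : MemLp f ∞ μ) : ∃ f', BddMeas f' ∧ f =ᵐ[μ] f' := by
  have hfm := hf.1
  set h := hfm.mk f
  have hm : Measurable h := hfm.stronglyMeasurable_mk.measurable
  set C := (eLpNorm f ∞ μ).toReal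
  have hbound : ∀ᵐ x ∂μ, ‖f x‖ ≤ C := by
    have := ae_le_eLpNormEssSup (f := f) (μ := μ)
    rw [← eLpNorm_exponent_top] at this
    filter_upwards [this] with x hx
    simpa only [toReal_enorm] using ENNReal.toReal_mono hf.2.ne hx
  refine ⟨fun x => if ‖h x‖ ≤ C then h x else 0,
    ⟨Measurable.ite (measurableSet_le hm.norm measurable_const) hm measurable_const, C, fun x => ?_⟩,
    ?_⟩
  · dsimp only
    split_ifs with hx
    · exact hx
    · rw [norm_zero]
      exact ENNReal.toReal_nonneg
  · filter_upwards [hfm.ae_eq_mk, hbound] with x h1 h2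
    have h3 : f x = h x := h1
    rw [← h3, if_pos h2]

end Conclusion
end TemperedErgodic

/-! ### The main theorem -/

open TemperedErgodic

theorem mainTheorem5 {X : Type*} [MeasurableSpace X] (μ : Measure X) [IsProbabilityMeasure μ]
    (ℓ : ℕ) (hℓ : 1 ≤ ℓ) (T : Fin ℓ → X ≃ᵐ X)
    (hcomm : ∀ (i j : Fin ℓ) (x : X), T i (T j x) = T j (T i x))
    (hwm : ∀ i : Fin ℓ, TemperedErgodic.WeaklyMixing μ (T i))
    (f : Fin ℓ → X → ℂ) (hf : ∀ i : Fin ℓ, MemLp (f i) ∞ μ)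
    (g : Fin ℓ → ℝ → ℝ) (hg : ∀ i : Fin ℓ, TemperedErgodic.ClassT (g i))
    (hgrowth : ∀ i j : Fin ℓ, (i : ℕ) + 1 = (j : ℕ) → TemperedErgodic.GrowsSlower (g j) (g i)) :
    Tendsto
      (fun N : ℕ => eLpNorm
        (fun x : X => TemperedErgodic.ergodicAverage T g f N x - ∏ i : Fin ℓ, ∫ y, f i y ∂μ) 2 μ)
      atTop (𝓝 0) := by
  obtain ⟨act, ha, hact⟩ := exists_preservingAction (μ := μ) T hcomm
    fun i => (hwm i).measurePreserving
  have he : ∀ i, MixingAlong μ act (Pi.single i 1) := fun i => by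
    have h1 : act (Pi.single i 1) = T i := funext fun x => by rw [hact, zpow_one]; rfl
    refine MixingAlong.of_ergodic_prod ha ?_
    rw [h1]
    exact (hwm i).ergodic_prod
  -- Everywhere bounded representatives; measure preservation keeps the exceptional sets null along
  -- all the countably many iterates that occur.
  choose f' hf' hff' using fun i => exists_bddMeas_ae_eq (hf i)
  obtain ⟨C, hC1, hC⟩ := exists_common_bound hf'
  have hint : ∀ i, ∫ y, f i y ∂μ = ∫ y, f' i y ∂μ := fun i => integral_congr_ae (hff' i)
  set c := ∏ i, ∫ y, f' i y ∂μ
  have hU := uNull_prod_sub_prod ha hg hgrowth he hf'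
  have hlim := hU.tendsto_eLpNorm (B := C ^ Fintype.card (Fin ℓ) + ‖c‖)
    (fun n => ((ha.bddMeas_prod (fun i => Pi.single i ⌊g i n⌋) hf').sub (.const _)).1)
    fun n x => (norm_sub_le _ _).trans (add_le_add_left (norm_prod_le_pow fun i => hC i _) _)
  refine hlim.congr' ?_
  -- For N ≥ 1 the average of the constant c is c; at N = 0 it would be 0.
  filter_upwards [eventually_ge_atTop 1] with N hN
  have hN0 : (N : ℂ) ≠ 0 := by exact_mod_cast (by omega : N ≠ 0)
  have hae : ∀ᵐ x ∂μ, ∀ n : ℕ, ∀ i, f i (act (Pi.single i ⌊g i n⌋) x) =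
      f' i (act (Pi.single i ⌊g i n⌋) x) := by
    rw [ae_all_iff]
    intro n
    rw [ae_all_iff]
    intro i
    exact (ha.mp _).quasiMeasurePreserving.ae (hff' i)
  refine eLpNorm_congr_ae ?_
  filter_upwards [hae] with x hx
  simp only [ergodicAverage, hint]
  rw [Finset.sum_sub_distrib, mul_sub]
  congr 1
  · congr 1
    refine Finset.sum_congr rfl fun n _ => Finset.prod_congr rfl fun i _ => ?_
    rw [← hact, hx]
  · simp [hN0]
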